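/- A \emph{strictly skew-symmetric linking form} is a finite abelian group $M$ with a bilinear map $b\colon M\otimes M\to\mathbb{Q}/\mathbb{Z}$ such that $b(x,y)=-b(y,x)$ and $b(x,x)=0$ for all $x,y\in M$; morphisms of linking forms are group homomorphisms preserving $b$, and direct sums carry the orthogonal sum form. For an integer $k\ge 2$ let $W_k$ be $\mathbb{Z}/k\oplus\mathbb{Z}/k$ with standard generators $\rho=(1,0)$, $\sigma=(0,1)$ and the form determined by $b(\rho,\sigma)=-b(\sigma,\rho)=\tfrac1k$, $b(\rho,\rho)=b(\sigma,\sigma)=0$, and let $W_k^g$ be its $g$-fold direct sum. The \emph{$k$-rank} of $M$ is $r_k(M)=\max\{g\in\mathbb{N} : \text{there is a morphism } W_k^g\to M\}$, and the \emph{stable $k$-rank} is $\bar r_k(M)=\max\{r_k(M\oplus W_k^g)-g : g\in\mathbb{N}\}$. Two subgroups $N_1,N_2\le M$ are \emph{orthogonal} if $b(N_1,N_2)=b(N_2,N_1)=0$ and $N_1\cap N_2=0$. Let $L(M)_k$ be the simplicial complex whose vertices are the morphisms $f\colon W_k\to M$, a set of distinct vertices $\{f_0,\dots,f_p\}$ being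 a $p$-simplex if the images $f_i(W_k)$ are pairwise orthogonal. For a real number $c$, a space is \emph{$c$-connected} if it is nonempty when $c\ge -1$ and its homotopy groups $\pi_j$ (for $j=0$, its set of path components) are trivial at all base points for all integers $0\le j\le c$ (no condition if $c<-1$). For a simplicial complex $X$ and a simplex $\sigma$ of $X$, the link $\mathrm{lk}_X(\sigma)$ consists of the simplices $\zeta$ of $X$ disjoint from $\sigma$ such that $\sigma$ and $\zeta$ are both faces of some simplex of $X$; and $lCM(X)\ge n$ means that for every $p\ge 0$ the geometric realization of the link of every $p$-simplex of $X$ is $(n-p-2)$-connected. \textbf{Theorem.} Let $k\ge 2$ and $g\ge 0$ be integers and let $M$ be a strictly skew-symmetric linking form with $\bar r_k(M)\ge g$. Then the geometric realization $|L(M)_k|$ is $\tfrac12(g-4)$-connected, and $lCM(L(M)_k)\ge\tfrac12(g-1)$. -/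

import Mathlib

noncomputable section


universe u v

/-! ### Linking forms -/

namespace Linking

/-- The group `ℚ/ℤ`. -/
abbrev QModZ : Type := AddCircle (1 : ℚ)

/-- A bilinear pairing `M ⊗ M → ℚ/ℤ`. -/
abbrev Form (M : Type u) [AddCommGroup M] : Type u := M →+ M →+ QModZ

/-- Strict skew-symmetry: `b(x, y) = -b(y, x)` and `b(x, x) = 0`. -/
structure Form.IsStrictlySkew {M : Type u} [AddCommGroup M] (b : Form M) : Prop where
  skew : ∀ x y, b x y = -b y x
  self_eq_zero : ∀ x, b x x = 0

/-- Morphisms of linking forms: homomorphisms preserving the pairings. -/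
@[ext]
structure Hom {M : Type u} {N : Type v} [AddCommGroup M] [AddCommGroup N]
    (b : Form M) (c : Form N) where
  toFun : M →+ N
  map_form : ∀ x y, c (toFun x) (toFun y) = b x y

/-- The image of a morphism, as a subgroup of the target. -/
def Hom.range {M : Type u} {N : Type v} [AddCommGroup M] [AddCommGroup N]
    {b : Form M} {c : Form N} (f : Hom b c) : AddSubgroup N :=
  f.toFun.range

/-- The orthogonal complement of a subgroup. -/
def Form.orthogonal {M : Type u} [AddCommGroup M] (b : Form M) (N : AddSubgroup M) :
    AddSubgroup M where
  carrier := {x | ∀ y ∈ N, b x y = 0}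
  zero_mem' := by simp
  add_mem' := by
    intro x x' hx hx' y hy
    simp [hx y hy, hx' y hy]
  neg_mem' := by
    intro x hx y hy
    simp [hx y hy]

/-- Orthogonality of two subgroups (sub-linking forms). -/
def Form.AreOrthogonal {M : Type u} [AddCommGroup M] (b : Form M) (N₁ N₂ : AddSubgroup M) :
    Prop :=
  N₁ ≤ b.orthogonal N₂ ∧ N₂ ≤ b.orthogonal N₁ ∧ N₁ ⊓ N₂ = ⊥

/-- The orthogonal direct sum of two linking forms. -/
def Form.directSum {M : Type u} {N : Type v} [AddCommGroup M] [AddCommGroup N]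
    (b : Form M) (c : Form N) : Form (M × N) :=
  AddMonoidHom.mk'
    (fun x => (b x.1).comp (AddMonoidHom.fst M N) + (c x.2).comp (AddMonoidHom.snd M N))
    (by
      intro x y
      refine AddMonoidHom.ext fun z => ?_
      simp [add_add_add_comm])

/-- The `g`-fold orthogonal direct sum of a linking form. -/
def Form.power {M : Type u} [AddCommGroup M] (b : Form M) (g : ℕ) : Form (Fin g → M) :=
  AddMonoidHom.mk' (fun x => ∑ i, (b (x i)).comp (Pi.evalAddMonoidHom (fun _ => M) i)) (by
    intro x y
    ext z
    simp [Finset.sum_add_distrib, AddMonoidHom.finsetSum_apply])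

/-- The homomorphism `ℤ/k → ℚ/ℤ`, `n ↦ n/k`. -/
def divByK (k : ℕ) : ZMod k →+ QModZ :=
  ZMod.lift k ⟨zmultiplesHom QModZ (((1 / k : ℚ) : ℚ) : QModZ), by
    rcases Nat.eq_zero_or_pos k with rfl | hk
    · simp
    · have hk' : (k : ℚ) ≠ 0 := by exact_mod_cast hk.ne'
      rw [zmultiplesHom_apply, natCast_zsmul, ← AddCircle.coe_nsmul, nsmul_eq_mul,
        mul_one_div_cancel hk']
      exact AddCircle.coe_period 1⟩

/-- The underlying group `ℤ/k ⊕ ℤ/k` of the standard linking form. -/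
abbrev W (k : ℕ) : Type := ZMod k × ZMod k

/-- The standard form on `ℤ/k ⊕ ℤ/k`:
`b(ρ, σ) = 1/k = -b(σ, ρ)` and `b(ρ, ρ) = b(σ, σ) = 0` for `ρ = (1, 0)`, `σ = (0, 1)`. -/
def stdForm (k : ℕ) : Form (W k) :=
  AddMonoidHom.mk'
    (fun x => AddMonoidHom.mk' (fun y => divByK k (x.1 * y.2 - x.2 * y.1)) (by
      intro y z
      rw [← map_add]
      congr 1
      simp only [Prod.fst_add, Prod.snd_add]
      ring))
    (by
      intro x y
      refine AddMonoidHom.ext fun z => ?_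
      simp only [AddMonoidHom.mk'_apply, AddMonoidHom.add_apply, Prod.fst_add, Prod.snd_add]
      rw [← map_add]
      congr 1
      ring)

/-- The `k`-rank: the largest `g` for which there is a morphism `W_k^g → M`. For `k ≥ 2`
and finite `M` such morphisms are injective, so the set is bounded; it contains `0`. -/
def kRank (k : ℕ) {M : Type u} [AddCommGroup M] (b : Form M) : ℕ :=
  sSup {g : ℕ | Nonempty (Hom ((stdForm k).power g) b)}

/-- The stable `k`-rank: the maximum over `g` of `r_k(M ⊕ W_k^g) - g` (an integer). For `k ≥ 2`
and finite `M` these numbers are bounded above, by counting elements. -/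
def stableRank (k : ℕ) {M : Type u} [AddCommGroup M] (b : Form M) : ℤ :=
  sSup (Set.range fun g : ℕ => (kRank k (b.directSum ((stdForm k).power g)) : ℤ) - g)

/-- The complex `L(M)_k`: its vertices are the morphisms `W_k → M`, and a nonempty finite set of
vertices is a simplex if the images of its members are pairwise orthogonal. -/
def linkingComplex (k : ℕ) {M : Type u} [AddCommGroup M] (b : Form M) :
    AbstractSimplicialComplex (Hom (stdForm k) b) where
  faces := {s | s.Nonempty ∧
    ∀ f₁ ∈ s, ∀ f₂ ∈ s, f₁ ≠ f₂ → b.AreOrthogonal f₁.range f₂.range}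
  isRelLowerSet_faces := by
    intro s hs
    exact ⟨hs.1, fun t ht hne => ⟨hne, fun f₁ h₁ f₂ h₂ => hs.2 f₁ (ht h₁) f₂ (ht h₂)⟩⟩
  singleton_mem := by
    intro v
    refine ⟨Finset.singleton_nonempty v, fun f₁ h₁ f₂ h₂ hne => ?_⟩
    rw [Finset.mem_singleton] at h₁ h₂
    exact absurd (h₁.trans h₂.symm) hne

end Linking

/-! ### Simplicial complexes: realization, links, connectivity -/

namespace Complexes

/-- The points of the geometric realization, in barycentric coordinates. -/
def Realization {ι : Type u} (K : PreAbstractSimplicialComplex ι) : Type u :=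
  {t : ι →₀ ℝ // (∀ i, 0 ≤ t i) ∧ (∑ i ∈ t.support, t i = 1) ∧ t.support ∈ K.faces}

/-- The closed simplex of `|K|` spanned by `s`. -/
def ClosedSimplex {ι : Type u} (K : PreAbstractSimplicialComplex ι) (s : Finset ι) : Type u :=
  {t : Realization K // t.1.support ⊆ s}

/-- A closed simplex has the topology given by the barycentric coordinates. -/
instance {ι : Type u} (K : PreAbstractSimplicialComplex ι) (s : Finset ι) :
    TopologicalSpace (ClosedSimplex K s) :=
  TopologicalSpace.induced (fun t => (fun i => t.1.1 i : ι → ℝ)) inferInstance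

/-- The weak topology: a subset of `|K|` is open iff its intersection with every closed simplex
is open in that simplex. -/
instance {ι : Type u} (K : PreAbstractSimplicialComplex ι) : TopologicalSpace (Realization K) :=
  ⨆ s : K.faces, TopologicalSpace.coinduced
    (fun t : ClosedSimplex K s.1 => t.1) inferInstance

/-- `c`-connectedness for a rational number `c`: for `c ≥ -1` the space is nonempty, and its
homotopy groups (for `j = 0`: its set of path components) are trivial in all degrees
`0 ≤ j ≤ c`. For `c < -1` there is no condition. -/
def IsNConnected (c : ℚ) (X : Type u) [TopologicalSpace X] : Prop :=
  (-1 ≤ c → Nonempty X) ∧ ∀ j : ℕ, (j : ℚ) ≤ c → ∀ x : X, Subsingleton (HomotopyGroup.Pi j X x)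

/-- The link of `σ`: all simplices disjoint from `σ` that lie with `σ` in a common simplex. -/
def link {ι : Type u} (K : PreAbstractSimplicialComplex ι) (σ : Finset ι) :
    PreAbstractSimplicialComplex ι where
  faces := {ζ | ζ ∈ K.faces ∧ Disjoint ζ σ ∧ ∃ ξ ∈ K.faces, σ ⊆ ξ ∧ ζ ⊆ ξ}
  isRelLowerSet_faces := by
    rintro s ⟨hs, hd, ξ, hξ, hσξ, hsξ⟩
    exact ⟨(K.isRelLowerSet_faces hs).1, fun t ht hne =>
      ⟨(K.isRelLowerSet_faces hs).2 ht hne, hd.mono_left ht, ξ, hξ, hσξ, ht.trans hsξ⟩⟩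

/-- `lCM(K) ≥ n`: the link of every `p`-simplex is `(n - p - 2)`-connected. -/
def LocallyCMGE {ι : Type u} (K : PreAbstractSimplicialComplex ι) (n : ℚ) : Prop :=
  ∀ (p : ℕ) (σ : Finset ι), σ ∈ K.faces → σ.card = p + 1 →
    IsNConnected (n - p - 2) (Realization (link K σ))

end Complexes

end

/-!
Connectivity is treated as an extension property. A set `X` is an `m`-extensor if every map to `X`
from a closed subset `A` of a closed set `Z` extends to `Z` when `Z \ A` has dimension less than
`m`. An `m`-extensor has trivial `π_j` for `j ≤ m - 2`, and the property glues: if `X₁` and `X₂` are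
closed `m`-extensors and `X₁ ∩ X₂` is an `(m - 1)`-extensor, then `X₁ ∪ X₂` is an `m`-extensor. So
complexes can be built up by attaching cones without van Kampen's theorem or homology.

For a subgroup `N` that contains the images of `g` pairwise orthogonal morphisms, the complex `L(N)`
of the morphisms with image in `N` is a `⌊g/2⌋`-extensor, by induction on `g`. Choose one such
morphism `v`, with `ρ` and `σ` the images of the standard generators, and consider the subgroups
`N₁ ≤ N₂ ≤ N`, where `N₂ = N ∩ ker b(ρ, -)` and `N₁ = N₂ ∩ ker b(σ, -)` is the orthogonal complement
of `v` in `N`. Vertices outside `N₁` are added to the cone over `L(N₁)` with apex `v` in two stages: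
first those in `N₂`, then the others. A simplex `τ` of new vertices is attached along the join of
its boundary with `L(P)`, where `P` is the orthogonal complement of `τ` in `N₁` or `N₂`,
respectively. In both stages `P` contains `g - |τ| - 1` orthogonal morphisms, and
`⌊(g - |τ| - 1)/2⌋ ≥ ⌊g/2⌋ - |τ|` is what the gluing requires.

Passing to the kernel of one functional costs at most one morphism, because unimodular changes of
basis make all but one of them vanish under it. In the first stage the second functional costs
nothing: `ρ` is orthogonal to all of `N₂`, so adding multiples of it moves any morphism into the
kernel of `b(σ, -)`.
-/

noncomputable section

open Set Topology TopologicalSpace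

namespace Complexes

/-! ### Dimension -/

section Dimension

variable {Y : Type u} [TopologicalSpace Y] {D D' : Set Y}

lemma frontier_diff_biUnion_closure_subset {G : Set Y} {H : ℕ → Set Y} (hG : IsOpen G)
    (hH : ∀ j, IsOpen (H j)) (hGD : frontier G ⊆ D) (hHD : ∀ j, frontier (H j) ⊆ D) (n : ℕ) :
    frontier (G \ ⋃ j ∈ Iic n, closure (H j)) ⊆ D := by
  have hclosed : IsClosed (⋃ j ∈ Iic n, closure (H j)) :=
    (finite_Iic n).isClosed_biUnion fun _ _ => isClosed_closure
  rw [(hG.sdiff hclosed).frontier_eq]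
  rintro x ⟨hx, hxU⟩
  by_cases hxG : x ∈ G
  · obtain ⟨j, hj, hxj⟩ : ∃ j ∈ Iic n, x ∈ closure (H j) := by
      simpa only [mem_sdiff, hxG, true_and, not_not, mem_iUnion₂, exists_prop] using hxU
    refine hHD j ((hH j).frontier_eq ▸ ⟨hxj, fun hxH => ?_⟩)
    obtain ⟨y, hyH, -, hy⟩ := mem_closure_iff.1 hx (H j) (hH j) hxH
    exact hy (mem_biUnion hj (subset_closure hyH))
  · exact hGD (hG.frontier_eq ▸ ⟨closure_mono sdiff_subset hx, hxG⟩)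

lemma exists_isOpen_frontier_subset_of_seq {A₁ A₂ : Set Y} {G H : ℕ → Set Y}
    (hG : ∀ i, IsOpen (G i)) (hH : ∀ i, IsOpen (H i)) (hGD : ∀ i, frontier (G i) ⊆ D)
    (hHD : ∀ i, frontier (H i) ⊆ D) (hGA : ∀ i, Disjoint (closure (G i)) A₂)
    (hHA : ∀ i, Disjoint (closure (H i)) A₁) (hAG : A₁ \ A₂ ⊆ ⋃ i, G i) (hAH : A₁ᶜ ⊆ ⋃ i, H i) :
    ∃ O, IsOpen O ∧ A₁ \ A₂ ⊆ O ∧ closure O ∩ A₂ ⊆ A₁ ∧ frontier O \ (A₁ ∩ A₂) ⊆ D := by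
  set U : ℕ → Set Y := fun i => G i \ ⋃ j ∈ Iic i, closure (H j)
  have hUopen : ∀ i, IsOpen (U i) := fun i =>
    (hG i).sdiff ((finite_Iic i).isClosed_biUnion fun _ _ => isClosed_closure)
  have hAU : A₁ \ A₂ ⊆ ⋃ i, U i := fun x hx => by
    obtain ⟨i, hi⟩ := mem_iUnion.1 (hAG hx)
    refine mem_iUnion.2 ⟨i, hi, ?_⟩
    simp only [mem_iUnion, not_exists]
    exact fun j _ hxj => disjoint_left.1 (hHA j) hxj hx.1
  -- `H j` meets only finitely many `U i`
  have hlocal : ∀ x ∈ closure (⋃ i, U i), x ∉ A₁ → ∃ i, x ∈ closure (U i) := by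
    intro x hx hxA
    obtain ⟨j, hj⟩ := mem_iUnion.1 (hAH hxA)
    have hsub : H j ∩ ⋃ i, U i ⊆ ⋃ i ∈ Iio j, U i := by
      rintro y ⟨hyH, hy⟩
      obtain ⟨i, hyG, hyi⟩ := mem_iUnion.1 hy
      refine mem_biUnion (mem_Iio.2 (lt_of_not_ge fun hji => hyi ?_)) ⟨hyG, hyi⟩
      exact mem_biUnion (mem_Iic.2 hji) (subset_closure hyH)
    have := closure_mono hsub ((hH j).inter_closure ⟨hj, hx⟩)
    rw [(finite_Iio j).closure_biUnion] at this
    exact (mem_iUnion₂.1 this).imp fun i hi => hi.2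
  refine ⟨⋃ i, U i, isOpen_iUnion hUopen, hAU, ?_, ?_⟩
  · rintro x ⟨hx, hxA₂⟩
    by_contra hxA₁
    obtain ⟨i, hi⟩ := hlocal x hx hxA₁
    exact disjoint_left.1 (hGA i) (closure_mono sdiff_subset hi) hxA₂
  · rintro x ⟨hx, hxA⟩
    rw [(isOpen_iUnion hUopen).frontier_eq] at hx
    by_cases hxA₁ : x ∈ A₁
    · exact absurd (hAU ⟨hxA₁, fun hxA₂ => hxA ⟨hxA₁, hxA₂⟩⟩) hx.2
    · obtain ⟨i, hi⟩ := hlocal x hx.1 hxA₁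
      refine frontier_diff_biUnion_closure_subset (hG i) hH (hGD i) hHD i ?_
      exact (hUopen i).frontier_eq ▸ ⟨hi, fun hxi => hx.2 (mem_iUnion.2 ⟨i, hxi⟩)⟩

lemma exists_seq_closure_disjoint [RegularSpace Y] [SecondCountableTopology Y]
    {𝓑 : Set (Set Y)} (h𝓑 : IsTopologicalBasis 𝓑) {A : Set Y} (hA : IsClosed A) :
    ∃ V : ℕ → Set Y, (∀ i, V i ∈ insert ∅ 𝓑) ∧ (∀ i, Disjoint (closure (V i)) A) ∧
      Aᶜ ⊆ ⋃ i, V i := by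
  obtain ⟨𝓒, h𝓒𝓑, h𝓒count, h𝓒⟩ := h𝓑.exists_countable
  have hcount : (insert ∅ {V ∈ 𝓒 | Disjoint (closure V) A}).Countable :=
    (h𝓒count.mono (sep_subset _ _)).insert ∅
  obtain ⟨V, hV⟩ := hcount.exists_eq_range (insert_nonempty _ _)
  have hVmem : ∀ i, V i ∈ insert ∅ {V ∈ 𝓒 | Disjoint (closure V) A} := fun i =>
    hV ▸ mem_range_self i
  refine ⟨V, fun i => ?_, fun i => ?_, fun x hx => ?_⟩
  · exact (hVmem i).imp_right fun h => h𝓒𝓑 h.1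
  · rcases hVmem i with h | h
    · simp [h]
    · exact h.2
  · obtain ⟨W, hW𝓒, hxW, hWA⟩ := h𝓒.exists_closure_subset (hA.isOpen_compl.mem_nhds hx)
    obtain ⟨i, rfl⟩ : W ∈ range V :=
      hV ▸ mem_insert_of_mem _ ⟨hW𝓒, disjoint_left.2 fun y hy => hWA hy⟩
    exact mem_iUnion.2 ⟨i, hxW⟩

lemma exists_isOpen_frontier_subset [RegularSpace Y] [SecondCountableTopology Y]
    (hD : IsTopologicalBasis {V : Set Y | IsOpen V ∧ frontier V ⊆ D}) {A₁ A₂ : Set Y}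
    (hA₁ : IsClosed A₁) (hA₂ : IsClosed A₂) :
    ∃ O, IsOpen O ∧ A₁ \ A₂ ⊆ O ∧ closure O ∩ A₂ ⊆ A₁ ∧ frontier O \ (A₁ ∩ A₂) ⊆ D := by
  have hinsert : insert ∅ {V : Set Y | IsOpen V ∧ frontier V ⊆ D} =
      {V | IsOpen V ∧ frontier V ⊆ D} :=
    insert_eq_of_mem ⟨isOpen_empty, by simp⟩
  obtain ⟨G, hG, hGA, hAG⟩ := exists_seq_closure_disjoint hD hA₂
  obtain ⟨H, hH, hHA, hAH⟩ := exists_seq_closure_disjoint hD hA₁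
  rw [hinsert] at hG hH
  exact exists_isOpen_frontier_subset_of_seq (fun i => (hG i).1) (fun i => (hH i).1)
    (fun i => (hG i).2) (fun i => (hH i).2) hGA hHA (fun x hx => hAG hx.2) hAH

/-- `HasDimLT n D` says that the subset `D` of the space `Y` has dimension less than `n`. This is a
large inductive dimension relative to `Y`: closed sets of `Y`, which may intersect, are separated
away from their intersection by an open set whose frontier cuts `D` in smaller dimension. -/
def HasDimLT : ℕ → Set Y → Prop
  | 0, D => D = ∅
  | n + 1, D => ∀ ⦃A₁ A₂ : Set Y⦄, IsClosed A₁ → IsClosed A₂ →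
      ∃ O, IsOpen O ∧ A₁ \ A₂ ⊆ O ∧ closure O ∩ A₂ ⊆ A₁ ∧
        HasDimLT n (D ∩ (frontier O \ (A₁ ∩ A₂)))

lemma HasDimLT.mono_set {n : ℕ} (h : HasDimLT n D) (hD : D' ⊆ D) : HasDimLT n D' := by
  induction n generalizing D D' with
  | zero => exact subset_empty_iff.1 (hD.trans h.subset)
  | succ n ih =>
    intro A₁ A₂ hA₁ hA₂
    obtain ⟨O, hO, h₁, h₂, hdim⟩ := h hA₁ hA₂
    exact ⟨O, hO, h₁, h₂, ih hdim (inter_subset_inter_left _ hD)⟩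

lemma HasDimLT.succ [CompletelyNormalSpace Y] {n : ℕ} (h : HasDimLT n D) :
    HasDimLT (n + 1) D := by
  induction n generalizing D with
  | zero =>
    intro A₁ A₂ hA₁ hA₂
    have hsep : SeparatedNhds (A₁ \ A₂) (A₂ \ A₁) :=
      separatedNhds_iff_disjoint.2 <| completely_normal
        (disjoint_left.2 fun x hx hx' => hx'.2 (closure_minimal sdiff_subset hA₁ hx))
        (disjoint_left.2 fun x hx hx' => hx.2 (closure_minimal sdiff_subset hA₂ hx'))
    obtain ⟨O, O', hO, hO', hAO, hAO', hdisj⟩ := hsep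
    refine ⟨O, hO, hAO, fun x hx => ?_, by rw [h.subset.antisymm (empty_subset _)]; simp [HasDimLT]⟩
    by_contra hxA
    exact disjoint_left.1 (hdisj.closure_left hO') hx.1 (hAO' ⟨hx.2, hxA⟩)
  | succ n ih =>
    intro A₁ A₂ hA₁ hA₂
    obtain ⟨O, hO, h₁, h₂, hdim⟩ := h hA₁ hA₂
    exact ⟨O, hO, h₁, h₂, ih hdim⟩

lemma HasDimLT.mono [CompletelyNormalSpace Y] {n n' : ℕ} (h : HasDimLT n D) (hn : n ≤ n') :
    HasDimLT n' D :=
  Nat.le_induction h (fun _ _ ih => ih.succ) n' hn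

lemma HasDimLT.exists_isClosed_cover {n : ℕ} (h : HasDimLT (n + 1) D) {A₁ A₂ : Set Y}
    (hA₁ : IsClosed A₁) (hA₂ : IsClosed A₂) :
    ∃ Z₁ Z₂, IsClosed Z₁ ∧ IsClosed Z₂ ∧ Z₁ ∪ Z₂ = univ ∧ Z₁ ∩ (A₁ ∪ A₂) = A₁ ∧
      Z₂ ∩ (A₁ ∪ A₂) = A₂ ∧ HasDimLT n (D ∩ ((Z₁ ∩ Z₂) \ (A₁ ∪ A₂))) := by
  obtain ⟨O, hO, h₁, h₂, hdim⟩ := h hA₁ hA₂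
  refine ⟨closure O ∪ A₁, Oᶜ ∪ A₂, isClosed_closure.union hA₁, hO.isClosed_compl.union hA₂,
    ?_, ?_, ?_, hdim.mono_set ?_⟩
  · rw [eq_univ_iff_forall]
    intro x
    by_cases hx : x ∈ O
    · exact Or.inl (Or.inl (subset_closure hx))
    · exact Or.inr (Or.inl hx)
  · refine subset_antisymm ?_ fun x hx => ⟨Or.inr hx, Or.inl hx⟩
    rintro x ⟨hx | hx, hx' | hx'⟩
    exacts [hx', h₂ ⟨hx, hx'⟩, hx, hx]
  · refine subset_antisymm ?_ fun x hx => ⟨Or.inr hx, Or.inr hx⟩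
    rintro x ⟨hx | hx, hx' | hx'⟩
    exacts [by_contra fun hxA => hx (h₁ ⟨hx', hxA⟩), hx', hx, hx']
  · rintro x ⟨hxD, ⟨hx₁, hx₂⟩, hxA⟩
    simp only [mem_union, not_or] at hx₁ hx₂ hxA
    refine ⟨hxD, hO.frontier_eq ▸ ⟨hx₁.resolve_right hxA.1, hx₂.resolve_right hxA.2⟩, ?_⟩
    exact fun hx => hxA.1 hx.1

end Dimension

/-! ### Dimension of subspaces of `ℝ^ι` -/

section Strata

/-- The translate of `ℚ` by `s√2`. These sets are dense in `ℝ` and pairwise disjoint. -/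
def shiftedRat (s : ℕ) : Set ℝ := {t | ∃ q : ℚ, t = s * √2 + q}

lemma eq_of_mem_shiftedRat {r s : ℕ} {t : ℝ} (hr : t ∈ shiftedRat r) (hs : t ∈ shiftedRat s) :
    r = s := by
  obtain ⟨p, hp⟩ := hr
  obtain ⟨q, hq⟩ := hs
  by_contra hne
  have hne' : (r : ℝ) - s ≠ 0 := sub_ne_zero.2 (by exact_mod_cast hne)
  refine irrational_sqrt_two ⟨(q - p) / (r - s), ?_⟩
  push_cast
  rw [div_eq_iff hne']
  linarith

lemma exists_mem_shiftedRat_between (s : ℕ) {x y : ℝ} (h : x < y) :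
    ∃ t ∈ shiftedRat s, x < t ∧ t < y := by
  obtain ⟨q, hxq, hqy⟩ := exists_rat_btwn (sub_lt_sub_right h (s * √2))
  exact ⟨s * √2 + q, ⟨q, rfl⟩, by linarith, by linarith⟩

variable {ι : Type v}

lemma isTopologicalBasis_frontier_shiftedRat [Finite ι] (s : ℕ) :
    IsTopologicalBasis
      {V : Set (ι → ℝ) | IsOpen V ∧ frontier V ⊆ {x | ∃ c, x c ∈ shiftedRat s}} := by
  cases nonempty_fintype ι
  refine isTopologicalBasis_of_isOpen_of_nhds (fun V hV => hV.1) fun x W hxW hW => ?_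
  obtain ⟨ε, hε, hball⟩ := Metric.isOpen_iff.1 hW x hxW
  choose a ha hxa hax using fun c => exists_mem_shiftedRat_between s (sub_lt_self (x c) hε)
  choose b hb hxb hbx using fun c => exists_mem_shiftedRat_between s (lt_add_of_pos_right (x c) hε)
  have hopen : IsOpen (univ.pi fun c => Ioo (a c) (b c)) :=
    isOpen_set_pi finite_univ fun _ _ => isOpen_Ioo
  refine ⟨univ.pi fun c => Ioo (a c) (b c), ⟨hopen, ?_⟩, fun c _ => ⟨hax c, hxb c⟩, ?_⟩
  · rw [hopen.frontier_eq, closure_pi_set]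
    rintro y ⟨hy, hy'⟩
    obtain ⟨c, hc⟩ : ∃ c, y c ∉ Ioo (a c) (b c) := by simpa only [mem_univ_pi, not_forall] using hy'
    have hyc : y c ∈ Icc (a c) (b c) :=
      closure_minimal Ioo_subset_Icc_self isClosed_Icc (hy c (mem_univ c))
    rcases hyc.1.eq_or_lt with h | h
    · exact ⟨c, h ▸ ha c⟩
    · have : y c = b c := hyc.2.antisymm (not_lt.1 fun h' => hc ⟨h, h'⟩)
      exact ⟨c, this ▸ hb c⟩
  · refine fun y hy => hball ((dist_pi_lt_iff hε).2 fun c => abs_sub_lt_iff.2 ⟨?_, ?_⟩)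
    · linarith [(hy c (mem_univ c)).2, hbx c]
    · linarith [(hy c (mem_univ c)).1, hxa c]

variable {Y : Type u}

/-- The points of `Y` that have, in the coordinates `u`, a coordinate in each of the first `s`
translates of `ℚ`. Distinct translates need distinct coordinates, so this set has codimension
`s`. -/
def rationalStratum (u : Y → ι → ℝ) (s : ℕ) : Set Y := {y | ∀ r < s, ∃ c, u y c ∈ shiftedRat r}

lemma rationalStratum_eq_empty [Fintype ι] (u : Y → ι → ℝ) {s : ℕ} (h : Fintype.card ι < s) :
    rationalStratum u s = ∅ := by
  refine eq_empty_iff_forall_notMem.2 fun y hy => ?_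
  choose c hc using fun r : Fin s => hy r r.2
  have hinj : Function.Injective c := fun r r' hrr =>
    Fin.ext (eq_of_mem_shiftedRat (hc r) (hrr ▸ hc r'))
  exact absurd (Fintype.card_le_of_injective c hinj) (by simpa using h)

lemma hasDimLT_rationalStratum [Fintype ι] [TopologicalSpace Y] {u : Y → ι → ℝ} (hu : IsInducing u)
    {n s : ℕ} (h : Fintype.card ι < n + s) : HasDimLT n (rationalStratum u s) := by
  have := hu.secondCountableTopology
  have := hu.regularSpace
  induction n generalizing s with
  | zero => exact rationalStratum_eq_empty u (by omega)
  | succ n ih =>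
    intro A₁ A₂ hA₁ hA₂
    have hbasis : IsTopologicalBasis
        {V : Set Y | IsOpen V ∧ frontier V ⊆ {y | ∃ c, u y c ∈ shiftedRat s}} := by
      refine ((isTopologicalBasis_frontier_shiftedRat s).isInducing hu).of_isOpen_of_subset
        (fun V hV => hV.1) ?_
      rintro _ ⟨V, hV, rfl⟩
      exact ⟨hV.1.preimage hu.continuous, (hu.continuous.frontier_preimage_subset V).trans
        (preimage_mono hV.2)⟩
    obtain ⟨O, hO, h₁, h₂, hfr⟩ := exists_isOpen_frontier_subset hbasis hA₁ hA₂
    refine ⟨O, hO, h₁, h₂, (ih (s := s + 1) (by omega)).mono_set ?_⟩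
    rintro y ⟨hy, hyO⟩ r hr
    rcases Nat.lt_succ_iff_lt_or_eq.1 hr with hr | rfl
    exacts [hy r hr, hfr hyO]

lemma hasDimLT_univ_of_isInducing [Fintype ι] [TopologicalSpace Y] {u : Y → ι → ℝ}
    (hu : IsInducing u) : HasDimLT (Fintype.card ι + 1) (univ : Set Y) :=
  (hasDimLT_rationalStratum hu (s := 0) (by omega)).mono_set fun _ _ r hr => absurd hr r.not_lt_zero

end Strata

/-! ### Extension of maps -/

section Extensor

lemma exists_continuousOn_union {X Y : Type*} [TopologicalSpace X] [TopologicalSpace Y]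
    {S T : Set X} (hS : IsClosed S) (hT : IsClosed T) {f g : X → Y} (hf : ContinuousOn f S)
    (hg : ContinuousOn g T) (h : EqOn f g (S ∩ T)) :
    ∃ k : X → Y, ContinuousOn k (S ∪ T) ∧ EqOn k f S ∧ EqOn k g T := by
  classical
  have hkf : EqOn (S.piecewise f g) f S := piecewise_eqOn S f g
  have hkg : EqOn (S.piecewise f g) g T := fun x hx => by
    by_cases hxS : x ∈ S
    · rw [hkf hxS, h ⟨hxS, hx⟩]
    · exact piecewise_eq_of_notMem S f g hxS
  exact ⟨S.piecewise f g, (hf.congr hkf).union_of_isClosed (hg.congr hkg) hS hT, hkf, hkg⟩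

/-- `X` has the extension property for continuous maps defined on a closed subset `A` of a closed
set `Z` with `Z \ A` of dimension less than `m`. For polyhedra this amounts to
`(m - 2)`-connectedness. -/
def IsExtensor {E : Type*} [TopologicalSpace E] (m : ℕ) (X : Set E) : Prop :=
  ∀ ⦃Y : Type⦄ [TopologicalSpace Y] [CompletelyNormalSpace Y] ⦃Z A : Set Y⦄ ⦃f : Y → E⦄,
    IsClosed Z → IsClosed A → A ⊆ Z → HasDimLT m (Z \ A) → ContinuousOn f A → MapsTo f A X →
      ∃ g : Y → E, ContinuousOn g Z ∧ MapsTo g Z X ∧ EqOn g f A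

variable {E : Type*} [TopologicalSpace E] {X X₁ X₂ : Set E} {m n : ℕ}

lemma isExtensor_zero (X : Set E) : IsExtensor 0 X := by
  intro Y _ _ Z A f _ _ hAZ hdim hf hfX
  obtain rfl : A = Z := hAZ.antisymm (sdiff_eq_empty.1 hdim)
  exact ⟨f, hf, hfX, eqOn_refl f A⟩

lemma IsExtensor.anti (h : IsExtensor n X) (hmn : m ≤ n) : IsExtensor m X :=
  fun _ _ _ _ _ _ hZ hA hAZ hdim => h hZ hA hAZ (hdim.mono hmn)

lemma IsExtensor.nonempty [Nonempty E] (h : IsExtensor (m + 1) X) : X.Nonempty := by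
  have hdim : HasDimLT (m + 1) (univ : Set Unit) :=
    (hasDimLT_univ_of_isInducing (IsInducing.of_subsingleton fun _ : Unit => (Fin.elim0 : _ → ℝ)))
      |>.mono (by simp)
  obtain ⟨g, -, hg, -⟩ := h (f := fun _ => Classical.arbitrary E) isClosed_univ isClosed_empty
    (empty_subset _) (hdim.mono_set (subset_univ _)) (continuousOn_empty _) (mapsTo_empty _ _)
  exact ⟨g (), hg (mem_univ _)⟩

lemma exists_extension_of_cover {Y : Type*} [TopologicalSpace Y] {Z Z₁ Z₂ A : Set Y} {f : Y → E}
    (hZ : IsClosed Z) (hZ₁ : IsClosed Z₁) (hZ₂ : IsClosed Z₂) (hZZ : Z ⊆ Z₁ ∪ Z₂)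
    (hA : Z ∩ (Z₁ ∩ Z₂) ⊆ A) (hAZ : A ⊆ Z)
    (h₁ : ∃ g, ContinuousOn g (Z ∩ Z₁) ∧ MapsTo g (Z ∩ Z₁) X₁ ∧ EqOn g f (A ∩ Z₁))
    (h₂ : ∃ g, ContinuousOn g (Z ∩ Z₂) ∧ MapsTo g (Z ∩ Z₂) X₂ ∧ EqOn g f (A ∩ Z₂)) :
    ∃ g, ContinuousOn g Z ∧ MapsTo g Z (X₁ ∪ X₂) ∧ EqOn g f A := by
  obtain ⟨g₁, hg₁, hg₁X, hg₁f⟩ := h₁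
  obtain ⟨g₂, hg₂, hg₂X, hg₂f⟩ := h₂
  have hagree : EqOn g₁ g₂ (Z ∩ Z₁ ∩ (Z ∩ Z₂)) := fun x hx => by
    have hxA : x ∈ A := hA ⟨hx.1.1, hx.1.2, hx.2.2⟩
    rw [hg₁f ⟨hxA, hx.1.2⟩, hg₂f ⟨hxA, hx.2.2⟩]
  obtain ⟨g, hg, hgg₁, hgg₂⟩ :=
    exists_continuousOn_union (hZ.inter hZ₁) (hZ.inter hZ₂) hg₁ hg₂ hagree
  rw [← inter_union_distrib_left, inter_eq_left.2 hZZ] at hg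
  refine ⟨g, hg, fun x hx => ?_, fun x hx => ?_⟩
  · rcases hZZ hx with hx' | hx'
    · exact Or.inl (hgg₁ ⟨hx, hx'⟩ ▸ hg₁X ⟨hx, hx'⟩)
    · exact Or.inr (hgg₂ ⟨hx, hx'⟩ ▸ hg₂X ⟨hx, hx'⟩)
  · rcases hZZ (hAZ hx) with hx' | hx'
    · exact (hgg₁ ⟨hAZ hx, hx'⟩).trans (hg₁f ⟨hx, hx'⟩)
    · exact (hgg₂ ⟨hAZ hx, hx'⟩).trans (hg₂f ⟨hx, hx'⟩)

lemma IsExtensor.union (h₁ : IsExtensor (m + 1) X₁) (h₂ : IsExtensor (m + 1) X₂)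
    (h₁₂ : IsExtensor m (X₁ ∩ X₂)) (hX₁ : IsClosed X₁) (hX₂ : IsClosed X₂) :
    IsExtensor (m + 1) (X₁ ∪ X₂) := by
  intro Y _ _ Z A f hZ hA hAZ hdim hf hfX
  have hA_eq : A ∩ f ⁻¹' X₁ ∪ A ∩ f ⁻¹' X₂ = A := by
    rw [← inter_union_distrib_left, inter_eq_left]
    exact hfX
  obtain ⟨Z₁, Z₂, hZ₁, hZ₂, hZu, hZA₁, hZA₂, hdim₁₂⟩ := hdim.exists_isClosed_cover
    (hf.preimage_isClosed_of_isClosed hA hX₁) (hf.preimage_isClosed_of_isClosed hA hX₂)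
  rw [hA_eq] at hZA₁ hZA₂ hdim₁₂
  have hf₁ : MapsTo f (Z₁ ∩ A) X₁ := fun x hx => (hZA₁ ▸ hx).2
  have hf₂ : MapsTo f (Z₂ ∩ A) X₂ := fun x hx => (hZA₂ ▸ hx).2
  set Z₁₂ := Z ∩ (Z₁ ∩ Z₂)
  have hZ₁₂closed : IsClosed Z₁₂ := hZ.inter (hZ₁.inter hZ₂)
  -- first extend over the frontier, into `X₁ ∩ X₂`, and then over the two halves
  obtain ⟨g, hg, hgX, hgf⟩ := h₁₂ (f := f) hZ₁₂closed (hZ₁₂closed.inter hA) inter_subset_left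
    (hdim₁₂.mono_set fun x hx => have hxA : x ∉ A := fun h => hx.2 ⟨hx.1, h⟩
      ⟨⟨hx.1.1, hxA⟩, hx.1.2, hxA⟩)
    (hf.mono inter_subset_right)
    (fun x hx => ⟨hf₁ ⟨hx.1.2.1, hx.2⟩, hf₂ ⟨hx.1.2.2, hx.2⟩⟩)
  obtain ⟨k, hk, hkf, hkg⟩ := exists_continuousOn_union hA hZ₁₂closed hf hg
    fun x hx => (hgf hx.symm).symm
  have hextend : ∀ {W : Set Y} {X' : Set E}, IsClosed W → IsExtensor (m + 1) X' →
      MapsTo f (W ∩ A) X' → X₁ ∩ X₂ ⊆ X' → ∃ g', ContinuousOn g' (Z ∩ W) ∧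
        MapsTo g' (Z ∩ W) X' ∧ EqOn g' k ((A ∪ Z₁₂) ∩ W) := by
    intro W X' hW hX' hfX' hXX'
    refine hX' (hZ.inter hW) ((hA.union hZ₁₂closed).inter hW)
      (inter_subset_inter_left _ (union_subset hAZ inter_subset_left))
      (hdim.mono_set fun x hx => ⟨hx.1.1, fun hxA => hx.2 ⟨Or.inl hxA, hx.1.2⟩⟩)
      (hk.mono inter_subset_left) ?_
    rintro x ⟨hx | hx, hxW⟩
    · exact hkf hx ▸ hfX' ⟨hxW, hx⟩
    · exact hkg hx ▸ hXX' (hgX hx)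
  obtain ⟨G, hG, hGX, hGk⟩ := exists_extension_of_cover hZ hZ₁ hZ₂ (hZu ▸ subset_univ Z)
    subset_union_right (union_subset hAZ inter_subset_left)
    (hextend hZ₁ h₁ hf₁ inter_subset_left) (hextend hZ₂ h₂ hf₂ inter_subset_right)
  exact ⟨G, hG, hGX, fun x hx => (hGk (Or.inl hx)).trans (hkf hx)⟩

lemma IsExtensor.exists_continuousMap {X' : Type*} [TopologicalSpace X'] {e : X' → E}
    (he : IsEmbedding e) (h : IsExtensor m (range e)) {Y : Type} [TopologicalSpace Y]
    [CompletelyNormalSpace Y] (hY : HasDimLT m (univ : Set Y)) {A : Set Y} (hA : IsClosed A)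
    {f : Y → X'} (hf : ContinuousOn f A) : ∃ F : C(Y, X'), EqOn F f A := by
  obtain ⟨g, hg, hgX, hgf⟩ := h (f := e ∘ f) isClosed_univ hA (subset_univ A)
    (hY.mono_set (subset_univ _)) (he.continuous.comp_continuousOn hf) fun x _ => mem_range_self _
  choose F hF using fun y => hgX (mem_univ y)
  have hFc : Continuous F := by
    rw [he.continuous_iff, show e ∘ F = g from funext hF]
    exact continuousOn_univ.1 hg
  exact ⟨⟨F, hFc⟩, fun y hy => he.injective ((hF y).trans (hgf hy))⟩

end Extensor

section HomotopyGroup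

open scoped unitInterval Topology.Homotopy

lemma hasDimLT_univ_cylinder (j : ℕ) : HasDimLT (j + 2) (univ : Set (I × (Fin j → I))) := by
  have hu : IsInducing fun (w : I × (Fin j → I)) (i : Option (Fin j)) =>
      (i.elim (w.1 : ℝ) fun c => w.2 c) := by
    refine Topology.IsClosedEmbedding.isInducing <| Continuous.isClosedEmbedding ?_ fun w w' h => ?_
    · exact continuous_pi fun i => by cases i <;> simp only [Option.elim] <;> fun_prop
    · exact Prod.ext (Subtype.ext (congrFun h none))
        (funext fun i => Subtype.ext (congrFun h (some i)))
  simpa using hasDimLT_univ_of_isInducing hu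

lemma isClosed_boundary_cube (j : ℕ) : IsClosed (Cube.boundary (Fin j)) := by
  simp only [Cube.boundary, ofPred_exists]
  exact isClosed_iUnion_of_finite fun i =>
    (isClosed_eq (continuous_apply i) continuous_const).union
      (isClosed_eq (continuous_apply i) continuous_const)

lemma subsingleton_homotopyGroup_of_isExtensor {X E : Type*} [TopologicalSpace X]
    [TopologicalSpace E] {e : X → E} (he : IsEmbedding e) {j : ℕ}
    (h : IsExtensor (j + 2) (range e)) (x : X) : Subsingleton (HomotopyGroup.Pi j X x) := by
  refine ⟨fun p q => Quotient.inductionOn₂ p q fun p q => Quotient.sound ?_⟩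
  have hside : IsClosed {w : I × (Fin j → I) | w.2 ∈ Cube.boundary (Fin j)} :=
    (isClosed_boundary_cube j).preimage continuous_snd
  have hbot : IsClosed {w : I × (Fin j → I) | w.1 = 0} :=
    isClosed_eq continuous_fst continuous_const
  have htop : IsClosed {w : I × (Fin j → I) | w.1 = 1} :=
    isClosed_eq continuous_fst continuous_const
  obtain ⟨f, hf, hfp, hfq⟩ := exists_continuousOn_union (hbot.union hside) (htop.union hside)
    (p.1.continuous.comp continuous_snd).continuousOn
    (q.1.continuous.comp continuous_snd).continuousOn
    (by
      rintro w ⟨hw | hw, hw' | hw'⟩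
      · exact absurd (hw.symm.trans hw') zero_ne_one
      all_goals
        exact (GenLoop.boundary p w.2 ‹_›).trans (GenLoop.boundary q w.2 ‹_›).symm)
  obtain ⟨F, hF⟩ := h.exists_continuousMap he (hasDimLT_univ_cylinder j)
    ((hbot.union hside).union (htop.union hside)) hf
  have hFp : ∀ w : I × (Fin j → I), w.1 = 0 ∨ w.2 ∈ Cube.boundary (Fin j) → F w = p w.2 :=
    fun w hw => (hF (Or.inl hw)).trans (hfp hw)
  have hFq : ∀ w : I × (Fin j → I), w.1 = 1 ∨ w.2 ∈ Cube.boundary (Fin j) → F w = q w.2 :=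
    fun w hw => (hF (Or.inr hw)).trans (hfq hw)
  exact ⟨⟨⟨F, fun y => hFp (0, y) (Or.inl rfl), fun y => hFq (1, y) (Or.inl rfl)⟩,
    fun t y hy => hFp (t, y) (Or.inr hy)⟩⟩

end HomotopyGroup

/-! ### Polyhedra -/

section Polyhedron

/-- The coordinates of `t` in `s`, made nonnegative, and divided by their sum if it exceeds `1`. -/
def truncatedCoords {ι : Type*} [DecidableEq ι] (s : Finset ι) (t : ι → ℝ)
    (i : ι) : ℝ :=
  (if i ∈ s then max (t i) 0 else 0) / max (∑ j ∈ s, max (t j) 0) 1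

lemma truncatedCoords_nonneg {ι : Type*} [DecidableEq ι] (s : Finset ι) (t : ι → ℝ)
    (i : ι) : 0 ≤ truncatedCoords s t i := by
  unfold truncatedCoords
  split_ifs <;> positivity

variable {ι : Type*} [Fintype ι]

/-- The realization in `ι → ℝ` of a simplicial complex on the finite vertex set `ι`. Here and below
such a complex is encoded as a lower set of `Finset ι`, of which the empty simplex may be a
member. -/
def polyhedron (K : LowerSet (Finset ι)) : Set (ι → ℝ) :=
  {t | t ∈ stdSimplex ℝ ι ∧ ({i | t i ≠ 0} : Finset ι) ∈ K}

lemma mem_polyhedron_Iic {s : Finset ι} {t : ι → ℝ} :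
    t ∈ polyhedron (LowerSet.Iic s) ↔ t ∈ stdSimplex ℝ ι ∧ ∀ i ∉ s, t i = 0 := by
  simp [polyhedron, Finset.subset_iff, not_imp_comm]

lemma isClosed_polyhedron (K : LowerSet (Finset ι)) : IsClosed (polyhedron K) := by
  have hface (s : Finset ι) : IsClosed (polyhedron (LowerSet.Iic s)) := by
    have hs : polyhedron (LowerSet.Iic s) = stdSimplex ℝ ι ∩ ⋂ i ∉ s, {t | t i = 0} := by
      ext t
      simpa only [mem_inter_iff, mem_iInter, mem_ofPred_eq] using mem_polyhedron_Iic
    rw [hs]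
    exact (isClosed_stdSimplex ℝ ι).inter <| isClosed_biInter fun i _ =>
      isClosed_eq (continuous_apply i) continuous_const
  have hK : polyhedron K = ⋃ s ∈ K, polyhedron (LowerSet.Iic s) := by
    ext t
    simp only [polyhedron, mem_iUnion, exists_prop]
    exact ⟨fun ht => ⟨_, ht.2, ht.1, LowerSet.mem_Iic_iff.2 le_rfl⟩,
      fun ⟨s, hs, ht, hts⟩ => ⟨ht, K.lower hts hs⟩⟩
  rw [hK]
  exact (toFinite (K : Set (Finset ι))).isClosed_biUnion fun s _ => hface s

lemma polyhedron_sup (K L : LowerSet (Finset ι)) :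
    polyhedron (K ⊔ L) = polyhedron K ∪ polyhedron L := by
  ext t
  exact and_or_left

lemma polyhedron_inf (K L : LowerSet (Finset ι)) :
    polyhedron (K ⊓ L) = polyhedron K ∩ polyhedron L := by
  ext t
  exact and_and_left

section Retraction

variable [DecidableEq ι] {s : Finset ι} {v : ι}

/-- A retraction of `ι → ℝ` onto the simplex with vertex set `s`, for a vertex `v` of `s`. The mass
missing from the truncated coordinates is put on `v`. -/
def simplexRetraction (s : Finset ι) (v : ι) (t : ι → ℝ) : ι → ℝ :=
  truncatedCoords s t + Pi.single v (1 - ∑ i, truncatedCoords s t i)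

lemma sum_truncatedCoords_le_one (t : ι → ℝ) : ∑ i, truncatedCoords s t i ≤ 1 := by
  simp only [truncatedCoords, ← Finset.sum_div, Finset.sum_ite_mem, Finset.univ_inter]
  exact div_le_one_of_le₀ (le_max_left _ _) (by positivity)

lemma truncatedCoords_eq_self {t : ι → ℝ} (ht : t ∈ polyhedron (LowerSet.Iic s)) :
    truncatedCoords s t = t := by
  obtain ⟨⟨hnonneg, hsum⟩, hs⟩ := mem_polyhedron_Iic.1 ht
  have hsum' : ∑ j ∈ s, max (t j) 0 = 1 := by
    simp only [fun j => max_eq_left (hnonneg j)]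
    rw [Finset.sum_subset s.subset_univ fun i _ hi => hs i hi, hsum]
  funext i
  by_cases hi : i ∈ s
  · simp [truncatedCoords, hi, hsum', hnonneg i]
  · simp [truncatedCoords, hi, hs i hi]

lemma simplexRetraction_mem (hv : v ∈ s) (t : ι → ℝ) :
    simplexRetraction s v t ∈ polyhedron (LowerSet.Iic s) := by
  refine mem_polyhedron_Iic.2 ⟨⟨fun i => ?_, ?_⟩, fun i hi => ?_⟩
  · refine add_nonneg (truncatedCoords_nonneg s t i) ?_
    exact (Pi.single_nonneg (α := fun _ => ℝ)).2 (sub_nonneg.2 (sum_truncatedCoords_le_one t)) i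
  · simp [simplexRetraction, Finset.sum_add_distrib]
  · have hiv : i ≠ v := fun h => hi (h ▸ hv)
    simp [simplexRetraction, truncatedCoords, hi, hiv]

lemma simplexRetraction_eq_self {t : ι → ℝ} (ht : t ∈ polyhedron (LowerSet.Iic s)) :
    simplexRetraction s v t = t := by
  simp [simplexRetraction, truncatedCoords_eq_self ht, (mem_polyhedron_Iic.1 ht).1.2]

lemma continuous_simplexRetraction : Continuous (simplexRetraction s v) := by
  have htrunc : Continuous (truncatedCoords s) := by
    refine continuous_pi fun i => Continuous.div ?_ (by fun_prop) fun t => by positivity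
    split_ifs <;> fun_prop
  refine htrunc.add ((continuous_single v).comp ?_)
  fun_prop

end Retraction

lemma isExtensor_simplex (m : ℕ) {s : Finset ι} (hs : s.Nonempty) :
    IsExtensor m (polyhedron (LowerSet.Iic s)) := by
  classical
  obtain ⟨v, hv⟩ := hs
  intro Y _ _ Z A f _ hA _ _ hf hfX
  obtain ⟨g, hg⟩ := ContinuousMap.exists_restrict_eq hA ⟨A.domRestrict f, hf.domRestrict⟩
  refine ⟨simplexRetraction s v ∘ g, (continuous_simplexRetraction.comp g.continuous).continuousOn,
    fun x _ => simplexRetraction_mem hv _, fun x hx => ?_⟩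
  have hgf : g x = f x := congrArg (fun k => k ⟨x, hx⟩) hg
  rw [Function.comp_apply, hgf, simplexRetraction_eq_self (hfX hx)]

end Polyhedron

/-! ### Connectivity of finite complexes -/

section Conn

variable {ι : Type*} [Fintype ι] {m n : ℕ} {K L : LowerSet (Finset ι)}

/-- The polyhedron of `K` is an `m`-extensor; a form of `(m - 2)`-connectedness. -/
def Conn (m : ℕ) (K : LowerSet (Finset ι)) : Prop := IsExtensor m (polyhedron K)

lemma Conn.anti (h : Conn n K) (hmn : m ≤ n) : Conn m K := IsExtensor.anti h hmn

lemma conn_zero (K : LowerSet (Finset ι)) : Conn 0 K := isExtensor_zero _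

lemma conn_Iic (m : ℕ) {s : Finset ι} (hs : s.Nonempty) : Conn m (LowerSet.Iic s) :=
  isExtensor_simplex m hs

lemma Conn.sup (hK : Conn m K) (hL : Conn m L) (hKL : Conn (m - 1) (K ⊓ L)) :
    Conn m (K ⊔ L) := by
  cases m with
  | zero => exact conn_zero _
  | succ m =>
    rw [Conn, polyhedron_sup]
    rw [Conn, polyhedron_inf] at hKL
    exact IsExtensor.union hK hL hKL (isClosed_polyhedron K) (isClosed_polyhedron L)

lemma conn_iSup_Iic {α : Type*} (m : ℕ) {s : Finset α} (hs : s.Nonempty) {φ : α → Finset ι} {v : ι}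
    (hv : ∀ a ∈ s, v ∈ φ a) : Conn m (⨆ a ∈ s, LowerSet.Iic (φ a)) := by
  classical
  induction hs using Finset.Nonempty.cons_induction generalizing m φ with
  | singleton a => simpa using conn_Iic m ⟨v, hv a (Finset.mem_singleton_self a)⟩
  | cons a s ha _ ih =>
    have hvs : ∀ b ∈ s, v ∈ φ b := fun b hb => hv b (Finset.mem_cons_of_mem hb)
    have hva : v ∈ φ a := hv a (Finset.mem_cons_self a s)
    have hinf : LowerSet.Iic (φ a) ⊓ ⨆ b ∈ s, LowerSet.Iic (φ b) =
        ⨆ b ∈ s, LowerSet.Iic (φ a ∩ φ b) := by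
      simp only [inf_iSup_eq, ← LowerSet.Iic_inf, Finset.inf_eq_inter]
    simp only [Finset.mem_cons, iSup_or, iSup_sup_eq, iSup_iSup_eq_left]
    refine (conn_Iic m ⟨v, hva⟩).sup (ih m hvs) (hinf ▸ ih (m - 1) fun b hb => ?_)
    exact Finset.mem_inter.2 ⟨hva, hvs b hb⟩

variable [DecidableEq ι]

lemma conn_of_insert_mem (m : ℕ) {v : ι} (hK : (K : Set (Finset ι)).Nonempty)
    (hv : ∀ σ ∈ K, insert v σ ∈ K) : Conn m K := by
  set s := (toFinite (K : Set (Finset ι))).toFinset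
  have hs : s.Nonempty := (Finite.toFinset_nonempty _).2 hK
  have hK_eq : K = ⨆ σ ∈ s, LowerSet.Iic (insert v σ) := by
    refine le_antisymm (fun σ hσ => ?_) (iSup₂_le fun σ hσ => ?_)
    · simp only [LowerSet.mem_iSup₂_iff, s, Finite.mem_toFinset, SetLike.mem_coe]
      exact ⟨σ, hσ, Finset.subset_insert v σ⟩
    · exact LowerSet.Iic_le.2 (hv σ (by simpa [s] using hσ))
  rw [hK_eq]
  exact conn_iSup_Iic m hs fun σ _ => Finset.mem_insert_self v σ

end Conn

section Gluing

variable {ι : Type*} [DecidableEq ι] {m : ℕ} {K L : LowerSet (Finset ι)}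

/-- The join of the full simplex on `σ` with `L`, for `L` with vertices outside `σ`. -/
def simplexJoin (σ : Finset ι) (L : LowerSet (Finset ι)) : LowerSet (Finset ι) where
  carrier := {ξ | ξ \ σ ∈ L}
  lower' := fun _ _ h hξ => L.lower (Finset.sdiff_subset_sdiff h le_rfl) hξ

/-- The join of the boundary of the simplex on `σ` with `L`, for `L` with vertices outside `σ`. -/
def boundaryJoin (σ : Finset ι) (L : LowerSet (Finset ι)) : LowerSet (Finset ι) :=
  simplexJoin σ L ⊓ (UpperSet.Ici σ).compl

lemma mem_simplexJoin {σ ξ : Finset ι} : ξ ∈ simplexJoin σ L ↔ ξ \ σ ∈ L := Iff.rfl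

lemma mem_boundaryJoin {σ ξ : Finset ι} : ξ ∈ boundaryJoin σ L ↔ ξ \ σ ∈ L ∧ ¬ σ ⊆ ξ := Iff.rfl

lemma boundaryJoin_singleton {v : ι} (hL : ∀ ξ ∈ L, v ∉ ξ) : boundaryJoin {v} L = L := by
  ext ξ
  change ξ ∈ boundaryJoin {v} L ↔ ξ ∈ L
  rw [mem_boundaryJoin, Finset.singleton_subset_iff]
  constructor
  · rintro ⟨hξ, hv⟩
    rwa [Finset.sdiff_singleton_eq_erase, Finset.erase_eq_of_notMem hv] at hξ
  · refine fun hξ => ⟨?_, hL ξ hξ⟩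
    rwa [Finset.sdiff_singleton_eq_erase, Finset.erase_eq_of_notMem (hL ξ hξ)]

lemma simplexJoin_mono {σ τ : Finset ι} (h : τ ⊆ σ) : simplexJoin τ L ≤ simplexJoin σ L :=
  fun _ hξ => L.lower (Finset.sdiff_subset_sdiff le_rfl h) hξ

/-- The second set in this decomposition is a cone with apex `v`. -/
lemma boundaryJoin_cons {v : ι} {τ : Finset ι} (hv : v ∉ τ) (hL : ∀ ξ ∈ L, v ∉ ξ) :
    boundaryJoin (Finset.cons v τ hv) L =
      simplexJoin τ L ⊔ simplexJoin (Finset.cons v τ hv) L ⊓ (UpperSet.Ici τ).compl := by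
  refine le_antisymm (fun ξ hξ => ?_) (sup_le (fun ξ hξ => ?_) ?_)
  · obtain ⟨hξL, hξ⟩ := mem_boundaryJoin.1 hξ
    by_cases hvξ : v ∈ ξ
    · exact Or.inr ⟨hξL, fun h => hξ (Finset.cons_subset.2 ⟨hvξ, h⟩)⟩
    · refine Or.inl ?_
      rwa [Finset.cons_eq_insert, Finset.sdiff_insert_of_notMem hvξ] at hξL
  · refine ⟨simplexJoin_mono (Finset.subset_cons hv) hξ, fun h => hL _ hξ ?_⟩
    exact Finset.mem_sdiff.2 ⟨h (Finset.mem_cons_self v τ), hv⟩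
  · exact inf_le_inf_left _ fun ξ hξ h => hξ ((Finset.subset_cons hv).trans h)

/-- The part with vertices in `V` of the link of `σ` in `X`. -/
def linkWithin (X : LowerSet (Finset ι)) (V σ : Finset ι) : LowerSet (Finset ι) where
  carrier := {τ | τ ⊆ V ∧ τ ∪ σ ∈ X}
  lower' := fun _ _ h hτ =>
    ⟨h.trans hτ.1, X.lower (Finset.union_subset_union_left h) hτ.2⟩

lemma simplexJoin_linkWithin_le (X : LowerSet (Finset ι)) (V σ : Finset ι) :
    simplexJoin σ (linkWithin X V σ) ≤ X := fun _ hξ =>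
  X.lower (Finset.subset_union_left.trans_eq Finset.sdiff_union_self_eq_union.symm) hξ.2

lemma sdiff_subset_of_mem_simplexJoin_linkWithin {X : LowerSet (Finset ι)} {V σ ξ : Finset ι}
    (hξ : ξ ∈ simplexJoin σ (linkWithin X V σ)) : ξ \ V ⊆ σ :=
  sdiff_le_comm.1 hξ.1

variable [Fintype ι]

lemma conn_simplexJoin (m : ℕ) {σ : Finset ι} (hσ : σ.Nonempty) (hL : ∅ ∈ L) :
    Conn m (simplexJoin σ L) := by
  obtain ⟨v, hv⟩ := hσ
  refine conn_of_insert_mem m (v := v) ⟨∅, ?_⟩ fun ξ hξ => ?_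
  · rwa [SetLike.mem_coe, mem_simplexJoin, Finset.empty_sdiff]
  · rwa [mem_simplexJoin, Finset.insert_sdiff_of_mem _ hv]

lemma conn_boundaryJoin {σ : Finset ι} (hσ : σ.Nonempty) (hL : ∅ ∈ L)
    (hdisj : ∀ ξ ∈ L, Disjoint ξ σ) (hconn : Conn (m + 1 - σ.card) L) :
    Conn m (boundaryJoin σ L) := by
  induction hσ using Finset.Nonempty.cons_induction generalizing m with
  | singleton v =>
    rw [boundaryJoin_singleton fun ξ hξ => Finset.disjoint_singleton_right.1 (hdisj ξ hξ)]
    simpa using hconn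
  | cons v τ hv hτ ih =>
    have hvL : ∀ ξ ∈ L, v ∉ ξ := fun ξ hξ hvξ =>
      Finset.disjoint_left.1 (hdisj ξ hξ) hvξ (Finset.mem_cons_self v τ)
    have hcone : Conn m (simplexJoin (Finset.cons v τ hv) L ⊓ (UpperSet.Ici τ).compl) := by
      refine conn_of_insert_mem m (v := v) ⟨∅, ?_, ?_⟩ fun ξ hξ => ⟨?_, fun h => hξ.2 ?_⟩
      · rwa [SetLike.mem_coe, mem_simplexJoin, Finset.empty_sdiff]
      · simpa using hτ.ne_empty
      · simpa only [SetLike.mem_coe, mem_simplexJoin,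
          Finset.insert_sdiff_of_mem ξ (Finset.mem_cons_self v τ)] using hξ.1
      · exact (Finset.subset_insert_iff_of_notMem hv).1 h
    rw [boundaryJoin_cons hv hvL]
    refine (conn_simplexJoin m hτ hL).sup hcone ?_
    rw [← inf_assoc, inf_eq_left.2 (simplexJoin_mono (Finset.subset_cons hv))]
    rcases m with _ | m
    · exact conn_zero _
    · refine ih (fun ξ hξ => (hdisj ξ hξ).mono_right (Finset.subset_cons hv)) (hconn.anti ?_)
      rw [Finset.card_cons]
      omega

/-- `T ⊓ simplexJoin σ L` is the boundary join, of which the assumption on `L` bounds the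
connectivity. -/
lemma Conn.sup_simplexJoin_linkWithin {T X : LowerSet (Finset ι)} {V σ : Finset ι}
    (hT : Conn m T) (hσ : σ.Nonempty) (hσX : σ ∈ X) (hσT : σ ∉ T) (hσV : Disjoint σ V)
    (hbd : boundaryJoin σ (linkWithin X V σ) ≤ T)
    (hlink : Conn (m - σ.card) (linkWithin X V σ)) :
    Conn m (T ⊔ simplexJoin σ (linkWithin X V σ)) := by
  have hempty : ∅ ∈ linkWithin X V σ := ⟨Finset.empty_subset V, by rwa [Finset.empty_union]⟩
  have hinf : T ⊓ simplexJoin σ (linkWithin X V σ) = boundaryJoin σ (linkWithin X V σ) :=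
    le_antisymm (fun ξ hξ => ⟨hξ.2, fun h => hσT (T.lower h hξ.1)⟩) (le_inf hbd inf_le_left)
  refine hT.sup (conn_simplexJoin m hσ hempty) ?_
  rw [hinf]
  rcases m with _ | m
  · exact conn_zero _
  · exact conn_boundaryJoin hσ hempty (fun ξ hξ => hσV.symm.mono_left hξ.1) hlink

/-- `X` is obtained from `T` by adding the simplices disjoint from `V`, in order of dimension,
together with their joins with simplices in `V`. -/
lemma conn_of_linkWithin {X T : LowerSet (Finset ι)} (V : Finset ι) (hTX : T ≤ X) (hT0 : ∅ ∈ T)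
    (hsat : ∀ ξ ∈ X, ξ \ V ∈ T → ξ ∈ T) (hT : Conn m T)
    (hlink : ∀ σ ∈ X, σ ∉ T → Disjoint σ V → Conn (m - σ.card) (linkWithin X V σ)) :
    Conn m X := by
  induction hn : ((X : Set (Finset ι)) \ T).ncard using Nat.strong_induction_on
    generalizing T with
  | _ n ih =>
  by_cases hXT : X ≤ T
  · rwa [← hTX.antisymm hXT]
  obtain ⟨ξ, hξX, hξT⟩ := not_subset.1 hXT
  obtain ⟨σ, ⟨hσX, hσT, hσV⟩, hσmin⟩ :=
    (toFinite {σ | σ ∈ X ∧ σ ∉ T ∧ Disjoint σ V}).exists_minimal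
      ⟨ξ \ V, X.lower Finset.sdiff_subset hξX, mt (hsat ξ hξX) hξT, Finset.sdiff_disjoint⟩
  have hσ0 : σ.Nonempty := Finset.nonempty_iff_ne_empty.2 fun h => hσT (h ▸ hT0)
  have hproper : ∀ ξ ∈ X, ξ \ V ⊆ σ → ξ \ V ≠ σ → ξ ∈ T := fun ξ hξ hξσ hne =>
    hsat ξ hξ <| by_contra fun hξT => hne <| hξσ.antisymm <|
      hσmin ⟨X.lower Finset.sdiff_subset hξ, hξT, Finset.sdiff_disjoint⟩ hξσ
  set J := simplexJoin σ (linkWithin X V σ) with hJ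
  have hbd : boundaryJoin σ (linkWithin X V σ) ≤ T := fun ξ hξ =>
    hproper ξ (simplexJoin_linkWithin_le X V σ hξ.1)
      (sdiff_subset_of_mem_simplexJoin_linkWithin hξ.1)
      fun h => hξ.2 (h.symm.subset.trans Finset.sdiff_subset)
  refine ih _ ?_ (T := T ⊔ J) (sup_le hTX (simplexJoin_linkWithin_le X V σ)) (Or.inl hT0) ?_
    (hT.sup_simplexJoin_linkWithin hσ0 hσX hσT hσV hbd (hlink σ hσX hσT hσV))
    (fun τ hτ hτT => hlink τ hτ fun h => hτT (Or.inl h)) rfl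
  · have hσJ : σ ∈ J := by
      rw [hJ, mem_simplexJoin, Finset.sdiff_self]
      exact ⟨Finset.empty_subset V, by rwa [Finset.empty_union]⟩
    refine hn ▸ ncard_lt_ncard ⟨sdiff_subset_sdiff_right subset_union_left, fun h => ?_⟩
    exact (h ⟨hσX, hσT⟩).2 (Or.inr hσJ)
  · rintro ξ hξ (hξT | hξJ)
    · exact Or.inl (hsat ξ hξ hξT)
    · have hξσ : ξ \ V ⊆ σ := by
        simpa using sdiff_subset_of_mem_simplexJoin_linkWithin hξJ
      by_cases h : ξ \ V = σ
      · refine Or.inr ⟨sdiff_le_comm.1 hξσ, ?_⟩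
        rwa [Finset.sdiff_union_of_subset (h.symm.subset.trans Finset.sdiff_subset)]
      · exact Or.inl (hproper ξ hξ hξσ h)

end Gluing

section Realization

variable {ι : Type*} {P : PreAbstractSimplicialComplex ι}

/-- The barycentric coordinates of a point. -/
def Realization.coords (x : Realization P) : ι → ℝ := x.1

lemma Realization.injective_coords (P : PreAbstractSimplicialComplex ι) :
    Function.Injective (coords (P := P)) :=
  fun _ _ h => Subtype.ext (DFunLike.coe_injective h)

lemma Realization.continuous_coords (P : PreAbstractSimplicialComplex ι) :
    Continuous (coords (P := P)) :=
  continuous_iSup_dom.2 fun _ => continuous_coinduced_dom.2 continuous_induced_dom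

lemma ClosedSimplex.continuous_val {s : Finset ι} (hs : s ∈ P.faces) :
    Continuous fun t : ClosedSimplex P s => t.1 :=
  continuous_iSup_rng (i := (⟨s, hs⟩ : P.faces)) continuous_coinduced_rng

/-- The faces of a complex together with the empty simplex. -/
def augmentedFaces (P : PreAbstractSimplicialComplex ι) : LowerSet (Finset ι) where
  carrier := {s | s.Nonempty → s ∈ P.faces}
  lower' := fun _ _ hts hs ht => (P.isRelLowerSet_faces (hs (ht.mono hts))).2 hts ht

lemma Realization.range_coords [Fintype ι] (P : PreAbstractSimplicialComplex ι) :
    range (coords (P := P)) = polyhedron (augmentedFaces P) := by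
  ext t
  constructor
  · rintro ⟨x, rfl⟩
    have hsupp : ({i | x.1 i ≠ 0} : Finset ι) = x.1.support := by ext; simp
    refine ⟨⟨x.2.1, ?_⟩, fun _ => hsupp ▸ x.2.2.2⟩
    exact (x.1.sum_fintype (fun _ r => r) fun _ => rfl).symm.trans x.2.2.1
  · rintro ⟨⟨hnonneg, hsum⟩, hface⟩
    let u : ι →₀ ℝ := Finsupp.equivFunOnFinite.symm t
    have hsupp : u.support = ({i | t i ≠ 0} : Finset ι) := by ext; simp [u]
    have husum : ∑ i ∈ u.support, u i = 1 :=
      (u.sum_fintype (fun _ r => r) fun _ => rfl).trans hsum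
    have hne : u.support.Nonempty :=
      Finset.nonempty_of_sum_ne_zero (husum.trans_ne one_ne_zero)
    exact ⟨⟨u, hnonneg, husum, by rw [hsupp] at hne ⊢; exact hface hne⟩, rfl⟩

lemma ClosedSimplex.isClosedEmbedding_coords [Finite ι] {s : Finset ι} (hs : s ∈ P.faces) :
    IsClosedEmbedding fun t : ClosedSimplex P s => t.1.coords := by
  cases nonempty_fintype ι
  refine ⟨⟨⟨rfl⟩, fun x y h => Subtype.ext (Realization.injective_coords P h)⟩, ?_⟩
  convert isClosed_polyhedron (LowerSet.Iic s) using 1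
  ext t
  rw [mem_polyhedron_Iic]
  constructor
  · rintro ⟨⟨x, hx⟩, rfl⟩
    have hxP : x.coords ∈ polyhedron (augmentedFaces P) :=
      Realization.range_coords P ▸ mem_range_self x
    exact ⟨hxP.1, fun i hi => Finsupp.notMem_support_iff.1 fun h => hi (hx h)⟩
  · rintro ⟨ht, hts⟩
    have htP : t ∈ range (Realization.coords (P := P)) := by
      rw [Realization.range_coords]
      refine ⟨ht, (P.isRelLowerSet_faces hs).2 fun i hi => ?_⟩
      exact by_contra fun his => (Finset.mem_filter.1 hi).2 (hts i his)
    obtain ⟨x, rfl⟩ := htP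
    exact ⟨⟨x, fun i hi => by_contra fun his => Finsupp.mem_support_iff.1 hi (hts i his)⟩, rfl⟩

lemma Realization.isClosedEmbedding_coords [Finite ι] (P : PreAbstractSimplicialComplex ι) :
    IsClosedEmbedding (coords (P := P)) := by
  refine .of_continuous_injective_isClosedMap (continuous_coords P) (injective_coords P)
    fun C hC => ?_
  have hunion : coords '' C = ⋃ s : P.faces,
      (fun t : ClosedSimplex P s => t.1.coords) '' {t | t.1 ∈ C} := by
    ext t
    simp only [mem_iUnion]
    constructor
    · rintro ⟨x, hx, rfl⟩
      exact ⟨⟨_, x.2.2.2⟩, ⟨x, subset_rfl⟩, hx, rfl⟩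
    · rintro ⟨s, x, hx, rfl⟩
      exact ⟨x.1, hx, rfl⟩
  rw [hunion]
  exact isClosed_iUnion_of_finite fun s => (ClosedSimplex.isClosedEmbedding_coords s.2).isClosedMap
    _ (hC.preimage (ClosedSimplex.continuous_val s.2))

lemma isNConnected_of_conn [Fintype ι] {m : ℕ} (hP : Conn m (augmentedFaces P)) {c : ℚ}
    (hc : ∀ n : ℕ, (n : ℚ) ≤ c + 2 → n ≤ m) : IsNConnected c (Realization P) := by
  have hrange := Realization.range_coords P
  refine ⟨fun h => ?_, fun j hj x => ?_⟩
  · obtain ⟨t, ht⟩ := IsExtensor.nonempty (hP.anti (hc (0 + 1) (by push_cast; linarith)))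
    rw [← hrange] at ht
    exact ⟨ht.choose⟩
  · have hext := hP.anti (hc (j + 2) (by push_cast; linarith))
    rw [Conn, ← hrange] at hext
    exact subsingleton_homotopyGroup_of_isExtensor
      (Realization.isClosedEmbedding_coords P).isEmbedding hext x

end Realization

end Complexes

namespace Linking

/-! ### Morphisms from the standard form -/

section StdForm

variable {k : ℕ}

lemma divByK_intCast (k : ℕ) (n : ℤ) : divByK k (n : ZMod k) = n • divByK k 1 := by
  rw [← map_zsmul, zsmul_one]

lemma divByK_one (k : ℕ) : divByK k 1 = ((1 / k : ℚ) : QModZ) := by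
  have h : divByK k ((1 : ℤ) : ZMod k) = (1 : ℤ) • ((1 / k : ℚ) : QModZ) := ZMod.lift_coe k _ 1
  rwa [Int.cast_one, one_zsmul] at h

lemma addOrderOf_divByK_one (hk : 0 < k) : addOrderOf (divByK k 1) = k := by
  rw [divByK_one]
  exact AddCircle.addOrderOf_period_div hk

lemma injective_divByK (hk : 0 < k) : Function.Injective (divByK k) := by
  refine (injective_iff_map_eq_zero _).2 fun x hx => ?_
  obtain ⟨n, rfl⟩ := ZMod.intCast_surjective x
  rw [divByK_intCast, ← addOrderOf_dvd_iff_zsmul_eq_zero, addOrderOf_divByK_one hk] at hx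
  exact (ZMod.intCast_zmod_eq_zero_iff_dvd n k).2 hx

lemma mem_zmultiples_divByK_one (hk : 0 < k) {y : QModZ} (hy : k • y = 0) :
    y ∈ AddSubgroup.zmultiples (divByK k 1) := by
  have hk' : (k : ℚ) ≠ 0 := by exact_mod_cast hk.ne'
  obtain ⟨q, rfl⟩ := QuotientAddGroup.mk_surjective y
  change k • (q : QModZ) = 0 at hy
  rw [← AddCircle.coe_nsmul, AddCircle.coe_eq_zero_iff] at hy
  obtain ⟨n, hn⟩ := hy
  refine ⟨n, ?_⟩
  change n • divByK k 1 = (q : QModZ)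
  rw [divByK_one, ← AddCircle.coe_zsmul]
  congr 1
  simp only [zsmul_eq_mul, mul_one, nsmul_eq_mul] at hn ⊢
  rw [hn]
  field_simp

lemma exists_unimodular_combination_eq_zero {A : Type*} [AddCommGroup A] {a x y : A}
    (hx : x ∈ AddSubgroup.zmultiples a) (hy : y ∈ AddSubgroup.zmultiples a) :
    ∃ p q r s : ℤ, p * s - q * r = 1 ∧ p • x + q • y = 0 := by
  obtain ⟨u, rfl⟩ := hx
  obtain ⟨v, rfl⟩ := hy
  rcases Nat.eq_zero_or_pos (Int.gcd u v) with h0 | hpos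
  · rw [Int.gcd_eq_zero_iff] at h0
    exact ⟨1, 0, 0, 1, by norm_num, by simp [h0.1]⟩
  · obtain ⟨u', v', hcoprime, hu, hv⟩ := Int.exists_gcd_one hpos
    obtain ⟨s, t, hst⟩ := Int.isCoprime_iff_gcd_eq_one.2 hcoprime
    refine ⟨v', -u', s, t, by linarith, ?_⟩
    generalize Int.gcd u v = d at hu hv
    simp only [hu, hv]
    module

lemma isStrictlySkew_stdForm (k : ℕ) : (stdForm k).IsStrictlySkew where
  skew x y := by
    change divByK k _ = -divByK k _
    rw [← map_neg]
    congr 1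
    ring
  self_eq_zero x := by
    change divByK k _ = 0
    rw [mul_comm, sub_self, map_zero]

lemma stdForm_apply (x y : W k) : stdForm k x y = divByK k (x.1 * y.2 - x.2 * y.1) := rfl

lemma eq_zero_of_forall_stdForm_eq_zero (hk : 0 < k) {x : W k} (hx : ∀ y, stdForm k x y = 0) :
    x = 0 := by
  simp only [stdForm_apply, map_eq_zero_iff _ (injective_divByK hk)] at hx
  ext
  · simpa using hx (0, 1)
  · simpa using hx (1, 0)

lemma exists_eq_intCast_pair (x : W k) : ∃ m n : ℤ, x = ((m : ZMod k), (n : ZMod k)) := by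
  obtain ⟨m, hm⟩ := ZMod.intCast_surjective x.1
  obtain ⟨n, hn⟩ := ZMod.intCast_surjective x.2
  exact ⟨m, n, Prod.ext hm.symm hn.symm⟩

lemma nsmul_W (x : W k) : k • x = 0 := by
  ext <;> simp

end StdForm

section Orthogonal

variable {M : Type*} [AddCommGroup M] {b : Form M} {N N' : AddSubgroup M}

lemma Form.orthogonal_anti (b : Form M) (h : N ≤ N') : b.orthogonal N' ≤ b.orthogonal N :=
  fun _ hx y hy => hx y (h hy)

lemma Form.orthogonal_sup (b : Form M) (N N' : AddSubgroup M) :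
    b.orthogonal (N ⊔ N') = b.orthogonal N ⊓ b.orthogonal N' := by
  refine le_antisymm (le_inf (b.orthogonal_anti le_sup_left) (b.orthogonal_anti le_sup_right)) ?_
  rintro x ⟨hx, hx'⟩ y hy
  exact (sup_le hx hx' : N ⊔ N' ≤ (b x).ker) hy

lemma Form.IsStrictlySkew.eq_zero_comm (hb : b.IsStrictlySkew) {x y : M} :
    b x y = 0 ↔ b y x = 0 := by
  rw [hb.skew, neg_eq_zero]

lemma Form.IsStrictlySkew.le_orthogonal_comm (hb : b.IsStrictlySkew) :
    N ≤ b.orthogonal N' ↔ N' ≤ b.orthogonal N :=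
  ⟨fun h _ hx _ hy => hb.eq_zero_comm.1 (h hy _ hx),
    fun h _ hx _ hy => hb.eq_zero_comm.1 (h hy _ hx)⟩

end Orthogonal

namespace Hom

variable {M : Type*} [AddCommGroup M] {k : ℕ} {b : Form M}

instance [NeZero k] [Finite M] : Finite (Hom (stdForm k) b) :=
  Finite.of_injective (fun f => (f.toFun : W k → M)) fun _ _ h =>
    Hom.ext (DFunLike.coe_injective h)

/-- The image of the first standard generator. -/
def rho (f : Hom (stdForm k) b) : M := f.toFun (1, 0)

/-- The image of the second standard generator. -/
def sigma (f : Hom (stdForm k) b) : M := f.toFun (0, 1)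

lemma nsmul_rho (f : Hom (stdForm k) b) : k • f.rho = 0 := by
  rw [rho, ← map_nsmul, nsmul_W, map_zero]

lemma nsmul_sigma (f : Hom (stdForm k) b) : k • f.sigma = 0 := by
  rw [sigma, ← map_nsmul, nsmul_W, map_zero]

lemma form_rho_sigma (f : Hom (stdForm k) b) : b f.rho f.sigma = divByK k 1 := by
  rw [rho, sigma, f.map_form, stdForm_apply]
  simp

lemma rho_mem_range (f : Hom (stdForm k) b) : f.rho ∈ f.range := ⟨_, rfl⟩

lemma sigma_mem_range (f : Hom (stdForm k) b) : f.sigma ∈ f.range := ⟨_, rfl⟩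

lemma range_le_iff (f : Hom (stdForm k) b) {N : AddSubgroup M} :
    f.range ≤ N ↔ f.rho ∈ N ∧ f.sigma ∈ N := by
  refine ⟨fun h => ⟨h f.rho_mem_range, h f.sigma_mem_range⟩, ?_⟩
  rintro ⟨hrho, hsigma⟩ _ ⟨x, rfl⟩
  obtain ⟨m, n, rfl⟩ := exists_eq_intCast_pair x
  have hx : ((m : ZMod k), (n : ZMod k)) = m • ((1, 0) : W k) + n • ((0, 1) : W k) := by
    ext <;> simp
  rw [hx, map_add, map_zsmul, map_zsmul]
  exact add_mem (zsmul_mem hrho m) (zsmul_mem hsigma n)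

lemma mem_orthogonal_range_iff (hb : b.IsStrictlySkew) (f : Hom (stdForm k) b) {x : M} :
    x ∈ b.orthogonal f.range ↔ b f.rho x = 0 ∧ b f.sigma x = 0 := by
  rw [hb.eq_zero_comm (x := f.rho), hb.eq_zero_comm (x := f.sigma)]
  exact f.range_le_iff (N := (b x).ker)

lemma not_range_le_orthogonal_self (hk : 2 ≤ k) (f : Hom (stdForm k) b) :
    ¬ f.range ≤ b.orthogonal f.range := by
  intro h
  have hone : addOrderOf (divByK k 1) = 1 := by
    rw [AddMonoid.addOrderOf_eq_one_iff, ← f.form_rho_sigma]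
    exact h f.rho_mem_range _ f.sigma_mem_range
  rw [addOrderOf_divByK_one (by omega)] at hone
  omega

lemma areOrthogonal_range_iff (hk : 0 < k) (hb : b.IsStrictlySkew) (f f' : Hom (stdForm k) b) :
    b.AreOrthogonal f.range f'.range ↔ f.range ≤ b.orthogonal f'.range := by
  refine ⟨fun h => h.1, fun h => ⟨h, hb.le_orthogonal_comm.1 h, ?_⟩⟩
  rw [eq_bot_iff]
  rintro _ ⟨⟨x, rfl⟩, hx⟩
  have hx0 : x = 0 := eq_zero_of_forall_stdForm_eq_zero hk fun y => by
    rw [← f.map_form, hb.eq_zero_comm]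
    exact h ⟨y, rfl⟩ _ hx
  rw [hx0, map_zero]
  exact zero_mem _

lemma exists_rho_eq_sigma_eq (hb : b.IsStrictlySkew) {x y : M} (hx : k • x = 0) (hy : k • y = 0)
    (hxy : b x y = divByK k 1) : ∃ f : Hom (stdForm k) b, f.rho = x ∧ f.sigma = y := by
  let φ : ZMod k →+ M := ZMod.lift k ⟨zmultiplesHom M x, by simpa using hx⟩
  let ψ : ZMod k →+ M := ZMod.lift k ⟨zmultiplesHom M y, by simpa using hy⟩
  have hφ (n : ℤ) : φ n = n • x := by simp [φ]
  have hψ (n : ℤ) : ψ n = n • y := by simp [ψ]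
  have hyx : b y x = -divByK k 1 := by rw [hb.skew, hxy]
  refine ⟨⟨φ.coprod ψ, fun w w' => ?_⟩, ?_, ?_⟩
  · obtain ⟨m, n, rfl⟩ := exists_eq_intCast_pair w
    obtain ⟨m', n', rfl⟩ := exists_eq_intCast_pair w'
    have hstd : stdForm k ((m : ZMod k), (n : ZMod k)) ((m' : ZMod k), (n' : ZMod k)) =
        (m * n' - n * m') • divByK k 1 := by
      rw [← divByK_intCast, stdForm_apply]
      push_cast
      rfl
    simp only [hstd, AddMonoidHom.coprod_apply, hφ, hψ, map_add, map_zsmul, AddMonoidHom.add_apply,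
      AddMonoidHom.zsmul_apply, hb.self_eq_zero, hxy, hyx]
    module
  · simpa [rho] using hφ 1
  · simpa [sigma] using hψ 1

end Hom

/-! ### Ranks of subgroups -/

section HyperbolicPairs

variable {M : Type*} [AddCommGroup M] {k : ℕ} {b : Form M}

lemma nsmul_zsmul_add_zsmul_eq_zero {x y : M} (hx : k • x = 0) (hy : k • y = 0) (m n : ℤ) :
    k • (m • x + n • y) = 0 := by
  rw [smul_add, smul_comm k m, smul_comm k n, hx, hy, smul_zero, smul_zero, add_zero]

lemma map_mem_zmultiples_divByK_one (hk : 0 < k) (l : M →+ QModZ) {x : M} (hx : k • x = 0) :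
    l x ∈ AddSubgroup.zmultiples (divByK k 1) :=
  mem_zmultiples_divByK_one hk (by rw [← map_nsmul, hx, map_zero])

lemma Hom.exists_map_rho_eq_zero (hk : 0 < k) (hb : b.IsStrictlySkew) (f : Hom (stdForm k) b)
    (l : M →+ QModZ) : ∃ f' : Hom (stdForm k) b, f'.range ≤ f.range ∧ l f'.rho = 0 := by
  obtain ⟨p, q, r, s, hdet, hl⟩ := exists_unimodular_combination_eq_zero
    (map_mem_zmultiples_divByK_one hk l f.nsmul_rho)
    (map_mem_zmultiples_divByK_one hk l f.nsmul_sigma)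
  have hform : b (p • f.rho + q • f.sigma) (r • f.rho + s • f.sigma) = divByK k 1 := by
    have hsigma : b f.sigma f.rho = -divByK k 1 := by rw [hb.skew, f.form_rho_sigma]
    calc b (p • f.rho + q • f.sigma) (r • f.rho + s • f.sigma)
        = (p * s - q * r) • divByK k 1 := by
          simp only [map_add, map_zsmul, AddMonoidHom.add_apply, AddMonoidHom.zsmul_apply,
            hb.self_eq_zero, f.form_rho_sigma, hsigma]
          module
      _ = divByK k 1 := by rw [hdet, one_smul]
  obtain ⟨f', hrho, hsigma⟩ := exists_rho_eq_sigma_eq hb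
    (nsmul_zsmul_add_zsmul_eq_zero f.nsmul_rho f.nsmul_sigma p q)
    (nsmul_zsmul_add_zsmul_eq_zero f.nsmul_rho f.nsmul_sigma r s) hform
  refine ⟨f', f'.range_le_iff.2 ?_, by simpa [hrho] using hl⟩
  rw [hrho, hsigma]
  exact ⟨add_mem (zsmul_mem f.rho_mem_range p) (zsmul_mem f.sigma_mem_range q),
    add_mem (zsmul_mem f.rho_mem_range r) (zsmul_mem f.sigma_mem_range s)⟩

lemma Hom.exists_unimodular_change (hb : b.IsStrictlySkew) {v w : Hom (stdForm k) b}
    (hvw : w.range ≤ b.orthogonal v.range) {p q r s : ℤ} (hdet : p * s - q * r = 1) :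
    ∃ v' w' : Hom (stdForm k) b, w'.range ≤ b.orthogonal v'.range ∧
      (v'.rho = -q • w.rho + p • v.rho ∧ v'.sigma = r • w.sigma + s • v.sigma) ∧
      (w'.rho = s • w.rho + -r • v.rho ∧ w'.sigma = p • w.sigma + q • v.sigma) := by
  have hwv {x y : M} (hx : x ∈ w.range) (hy : y ∈ v.range) : b x y = 0 := hvw hx y hy
  have hvw {x y : M} (hx : x ∈ v.range) (hy : y ∈ w.range) : b x y = 0 :=
    hb.eq_zero_comm.1 (hwv hy hx)
  have hrv := v.rho_mem_range
  have hsv := v.sigma_mem_range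
  have hrw := w.rho_mem_range
  have hsw := w.sigma_mem_range
  have hsrv : b v.sigma v.rho = -divByK k 1 := by rw [hb.skew, v.form_rho_sigma]
  have hsrw : b w.sigma w.rho = -divByK k 1 := by rw [hb.skew, w.form_rho_sigma]
  have hone : (p * s - q * r) • divByK k 1 = divByK k 1 := by rw [hdet, one_smul]
  obtain ⟨v', hrv', hsv'⟩ := exists_rho_eq_sigma_eq hb
    (nsmul_zsmul_add_zsmul_eq_zero w.nsmul_rho v.nsmul_rho (-q) p)
    (nsmul_zsmul_add_zsmul_eq_zero w.nsmul_sigma v.nsmul_sigma r s) (hone ▸ by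
      simp only [map_add, map_zsmul, AddMonoidHom.add_apply, AddMonoidHom.zsmul_apply,
        v.form_rho_sigma, w.form_rho_sigma, hwv hrw hsv, hvw hrv hsw]
      module)
  obtain ⟨w', hrw', hsw'⟩ := exists_rho_eq_sigma_eq hb
    (nsmul_zsmul_add_zsmul_eq_zero w.nsmul_rho v.nsmul_rho s (-r))
    (nsmul_zsmul_add_zsmul_eq_zero w.nsmul_sigma v.nsmul_sigma p q) (hone ▸ by
      simp only [map_add, map_zsmul, AddMonoidHom.add_apply, AddMonoidHom.zsmul_apply,
        v.form_rho_sigma, w.form_rho_sigma, hwv hrw hsv, hvw hrv hsw]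
      module)
  refine ⟨v', w', w'.range_le_iff.2 ?_, ⟨hrv', hsv'⟩, hrw', hsw'⟩
  simp only [v'.mem_orthogonal_range_iff hb, hrw', hsw', hrv', hsv', map_add, map_zsmul,
    AddMonoidHom.add_apply, AddMonoidHom.zsmul_apply, hb.self_eq_zero, v.form_rho_sigma,
    w.form_rho_sigma, hwv hrw hrv, hwv hrw hsv, hwv hsw hrv, hwv hsw hsv, hvw hrv hrw,
    hvw hrv hsw, hvw hsv hrw, hvw hsv hsw, hsrv, hsrw]
  refine ⟨⟨?_, ?_⟩, ?_, ?_⟩ <;> module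

lemma Hom.exists_orthogonal_pair_le_ker_of_map_rho_eq_zero (hk : 0 < k) (hb : b.IsStrictlySkew)
    {v w : Hom (stdForm k) b} (hvw : w.range ≤ b.orthogonal v.range) {l : M →+ QModZ}
    (hv : l v.rho = 0) (hw : l w.rho = 0) :
    ∃ v' w' : Hom (stdForm k) b, w'.range ≤ b.orthogonal v'.range ∧ w'.range ≤ l.ker ∧
      v'.range ⊔ w'.range ≤ v.range ⊔ w.range := by
  obtain ⟨p, q, r, s, hdet, hl⟩ := exists_unimodular_combination_eq_zero
    (map_mem_zmultiples_divByK_one hk l w.nsmul_sigma)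
    (map_mem_zmultiples_divByK_one hk l v.nsmul_sigma)
  obtain ⟨v', w', hvw', ⟨hrv', hsv'⟩, hrw', hsw'⟩ := exists_unimodular_change hb hvw hdet
  have hmem {x y : M} (hx : x ∈ w.range) (hy : y ∈ v.range) (m n : ℤ) :
      m • x + n • y ∈ v.range ⊔ w.range :=
    add_mem (AddSubgroup.mem_sup_right (zsmul_mem hx m))
      (AddSubgroup.mem_sup_left (zsmul_mem hy n))
  refine ⟨v', w', hvw', w'.range_le_iff.2 ?_,
    sup_le (v'.range_le_iff.2 ?_) (w'.range_le_iff.2 ?_)⟩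
  · simp [hrw', hsw', hv, hw, hl]
  · rw [hrv', hsv']
    exact ⟨hmem w.rho_mem_range v.rho_mem_range _ _, hmem w.sigma_mem_range v.sigma_mem_range _ _⟩
  · rw [hrw', hsw']
    exact ⟨hmem w.rho_mem_range v.rho_mem_range _ _, hmem w.sigma_mem_range v.sigma_mem_range _ _⟩

lemma Hom.exists_orthogonal_pair_le_ker (hk : 0 < k) (hb : b.IsStrictlySkew)
    {v w : Hom (stdForm k) b} (hvw : w.range ≤ b.orthogonal v.range) (l : M →+ QModZ) :
    ∃ v' w' : Hom (stdForm k) b, w'.range ≤ b.orthogonal v'.range ∧ w'.range ≤ l.ker ∧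
      v'.range ⊔ w'.range ≤ v.range ⊔ w.range := by
  obtain ⟨v₁, hv₁, hlv₁⟩ := v.exists_map_rho_eq_zero hk hb l
  obtain ⟨w₁, hw₁, hlw₁⟩ := w.exists_map_rho_eq_zero hk hb l
  have hvw₁ : w₁.range ≤ b.orthogonal v₁.range := hw₁.trans (hvw.trans (b.orthogonal_anti hv₁))
  obtain ⟨v', w', hvw', hker, hle⟩ :=
    exists_orthogonal_pair_le_ker_of_map_rho_eq_zero hk hb hvw₁ hlv₁ hlw₁
  exact ⟨v', w', hvw', hker, hle.trans (sup_le_sup hv₁ hw₁)⟩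

end HyperbolicPairs

section HasRank

variable {M : Type*} [AddCommGroup M] {k : ℕ} {b : Form M} {N N' : AddSubgroup M} {g g' : ℕ}

/-- `N` contains the images of `g` pairwise orthogonal morphisms from the standard form. They are
chosen one after the other, each in the orthogonal complement of the preceding ones. -/
def HasRank (k : ℕ) (b : Form M) : AddSubgroup M → ℕ → Prop
  | _, 0 => True
  | N, g + 1 => ∃ v : Hom (stdForm k) b, v.range ≤ N ∧ HasRank k b (N ⊓ b.orthogonal v.range) g

lemma HasRank.mono (h : HasRank k b N g) (hN : N ≤ N') (hg : g' ≤ g) : HasRank k b N' g' := by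
  induction g' generalizing N N' g with
  | zero => trivial
  | succ g' ih =>
    obtain ⟨g, rfl⟩ := Nat.exists_eq_add_of_le' (Nat.zero_lt_of_lt hg)
    obtain ⟨v, hv, h⟩ := h
    exact ⟨v, hv.trans hN, ih h (inf_le_inf_right _ hN) (Nat.le_of_succ_le_succ hg)⟩

lemma hasRank_card {ι : Type*} (s : Finset ι) (v : ι → Hom (stdForm k) b)
    (hN : ∀ i ∈ s, (v i).range ≤ N)
    (hv : ∀ i ∈ s, ∀ j ∈ s, i ≠ j → (v i).range ≤ b.orthogonal (v j).range) :
    HasRank k b N s.card := by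
  induction s using Finset.cons_induction generalizing N with
  | empty => trivial
  | cons i s hi ih =>
    simp only [Finset.forall_mem_cons] at hN hv
    rw [Finset.card_cons]
    refine ⟨v i, hN.1, ih (fun j hj => le_inf (hN.2 j hj) ?_) fun j hj => (hv.2 j hj).2⟩
    exact (hv.2 j hj).1 fun hji => hi (hji ▸ hj)

lemma HasRank.map {M' : Type*} [AddCommGroup M'] {b' : Form M'} (φ : M →+ M')
    (hφ : ∀ x ∈ N, ∀ y ∈ N, b' (φ x) (φ y) = b x y) (h : HasRank k b N g) :
    HasRank k b' (N.map φ) g := by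
  induction g generalizing N with
  | zero => trivial
  | succ g ih =>
    obtain ⟨v, hv, h⟩ := h
    let v' : Hom (stdForm k) b' := ⟨φ.comp v.toFun, fun x y => by
      simp only [AddMonoidHom.comp_apply]
      rw [hφ _ (hv ⟨x, rfl⟩) _ (hv ⟨y, rfl⟩), v.map_form]⟩
    refine ⟨v', ?_, (ih (N := N ⊓ b.orthogonal v.range)
      (fun x hx y hy => hφ x hx.1 y hy.1) h).mono ?_ le_rfl⟩
    · rintro _ ⟨x, rfl⟩
      exact ⟨_, hv ⟨x, rfl⟩, rfl⟩
    · rintro _ ⟨x, ⟨hxN, hxv⟩, rfl⟩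
      refine ⟨⟨x, hxN, rfl⟩, ?_⟩
      rintro _ ⟨y, rfl⟩
      exact (hφ x hxN _ (hv ⟨y, rfl⟩)).trans (hxv _ ⟨y, rfl⟩)

lemma HasRank.inf_ker_of_inf_orthogonal (hk : 0 < k) (hb : b.IsStrictlySkew)
    {v : Hom (stdForm k) b} (hv : v.range ≤ N) (h : HasRank k b (N ⊓ b.orthogonal v.range) g)
    (l : M →+ QModZ) : HasRank k b (N ⊓ l.ker) g := by
  induction g generalizing N v with
  | zero => trivial
  | succ g ih =>
    obtain ⟨w, hw, h⟩ := h
    obtain ⟨v', w', hvw', hl, hle⟩ :=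
      Hom.exists_orthogonal_pair_le_ker hk hb (hw.trans inf_le_right) l
    obtain ⟨hv'N, hw'N⟩ := sup_le_iff.1 (hle.trans (sup_le hv (hw.trans inf_le_left)))
    have horth : N ⊓ b.orthogonal v.range ⊓ b.orthogonal w.range ≤
        N ⊓ b.orthogonal w'.range ⊓ b.orthogonal v'.range := by
      have h := b.orthogonal_anti hle
      rw [b.orthogonal_sup, b.orthogonal_sup] at h
      rw [inf_assoc, inf_assoc, inf_comm (b.orthogonal w'.range)]
      exact inf_le_inf_left N h
    have hker := ih (le_inf hv'N (hb.le_orthogonal_comm.1 hvw')) (h.mono horth le_rfl)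
    exact ⟨w', le_inf hw'N hl, hker.mono (inf_right_comm _ _ _).le le_rfl⟩

lemma HasRank.inf_ker (hk : 0 < k) (hb : b.IsStrictlySkew) (h : HasRank k b N g)
    (l : M →+ QModZ) : HasRank k b (N ⊓ l.ker) (g - 1) := by
  cases g with
  | zero => trivial
  | succ g =>
    obtain ⟨v, hv, h⟩ := h
    exact h.inf_ker_of_inf_orthogonal hk hb hv l

lemma Hom.exists_range_le_inf_ker (hk : 0 < k) (hb : b.IsStrictlySkew) {v : Hom (stdForm k) b}
    (hv : v.range ≤ N) {x y : M} (hx : x ∈ N) (hkx : k • x = 0) (hxN : N ≤ (b x).ker)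
    (hxy : b x y = divByK k 1) :
    ∃ v' : Hom (stdForm k) b, v'.range ≤ N ⊓ (b y).ker ∧
      N ⊓ b.orthogonal v.range ≤ b.orthogonal v'.range := by
  obtain ⟨hrho, hsigma⟩ := v.range_le_iff.1 hv
  have hxl {z : M} (hz : z ∈ N) : b x z = 0 := hxN hz
  have hxr {z : M} (hz : z ∈ N) : b z x = 0 := hb.eq_zero_comm.1 (hxN hz)
  have hyx : b y x = -divByK k 1 := by rw [hb.skew, hxy]
  obtain ⟨m, hm : m • divByK k 1 = b y v.rho⟩ := map_mem_zmultiples_divByK_one hk (b y) v.nsmul_rho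
  obtain ⟨n, hn : n • divByK k 1 = b y v.sigma⟩ :=
    map_mem_zmultiples_divByK_one hk (b y) v.nsmul_sigma
  obtain ⟨v', hrho', hsigma'⟩ := exists_rho_eq_sigma_eq hb (x := v.rho + m • x)
    (y := v.sigma + n • x)
    (by simpa using nsmul_zsmul_add_zsmul_eq_zero v.nsmul_rho hkx 1 m)
    (by simpa using nsmul_zsmul_add_zsmul_eq_zero v.nsmul_sigma hkx 1 n)
    (by simp [v.form_rho_sigma, hxl hsigma, hxr hrho, hb.self_eq_zero])
  refine ⟨v', v'.range_le_iff.2 ?_, ?_⟩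
  · rw [hrho', hsigma']
    refine ⟨⟨add_mem hrho (zsmul_mem hx m), ?_⟩, add_mem hsigma (zsmul_mem hx n), ?_⟩
    · simp [hyx, hm]
    · simp [hyx, hn]
  · rintro z ⟨hzN, hz⟩
    replace hz := (v.mem_orthogonal_range_iff hb).1 hz
    rw [v'.mem_orthogonal_range_iff hb, hrho', hsigma']
    simp [hz, hxl hzN]

/-- A vector `x` in the radical of `N` with `b x y = 1/k` allows to project `N` to the kernel of
`b y` without changing the form. -/
lemma HasRank.inf_ker_of_radical (hk : 0 < k) (hb : b.IsStrictlySkew) {x y : M} (hx : x ∈ N)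
    (hkx : k • x = 0) (hxN : N ≤ (b x).ker) (hxy : b x y = divByK k 1) (h : HasRank k b N g) :
    HasRank k b (N ⊓ (b y).ker) g := by
  induction g generalizing N with
  | zero => trivial
  | succ g ih =>
    obtain ⟨v, hv, h⟩ := h
    obtain ⟨v', hv', horth⟩ := Hom.exists_range_le_inf_ker hk hb hv hx hkx hxN hxy
    have hx' : x ∈ N ⊓ b.orthogonal v'.range :=
      ⟨hx, fun z hz => hxN (hv' hz).1⟩
    have hker := ih hx' (inf_le_left.trans hxN) (h.mono (le_inf inf_le_left horth) le_rfl)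
    exact ⟨v', hv', hker.mono (inf_right_comm _ _ _).le le_rfl⟩

end HasRank

section Perp

variable {M : Type*} [AddCommGroup M] {k : ℕ} {b : Form M} {N N' : AddSubgroup M} {g : ℕ}
  {σ : Finset (Hom (stdForm k) b)}

/-- The subgroup of elements of `N` orthogonal to the images of all members of `σ`. -/
def perp (N : AddSubgroup M) (σ : Finset (Hom (stdForm k) b)) : AddSubgroup M :=
  N ⊓ ⨅ f ∈ σ, b.orthogonal f.range

lemma mem_perp {x : M} : x ∈ perp N σ ↔ x ∈ N ∧ ∀ f ∈ σ, x ∈ b.orthogonal f.range := by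
  simp [perp, AddSubgroup.mem_inf, AddSubgroup.mem_iInf]

lemma le_perp_iff : N' ≤ perp N σ ↔ N' ≤ N ∧ ∀ f ∈ σ, N' ≤ b.orthogonal f.range := by
  simp only [perp, le_inf_iff, le_iInf_iff]

lemma perp_inf (N N' : AddSubgroup M) (σ : Finset (Hom (stdForm k) b)) :
    perp (N ⊓ N') σ = perp N σ ⊓ N' := inf_right_comm _ _ _

lemma perp_cons {f : Hom (stdForm k) b} (hf : f ∉ σ) :
    perp N (Finset.cons f σ hf) = perp N σ ⊓ b.orthogonal f.range := by
  ext x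
  simp only [AddSubgroup.mem_inf, mem_perp, Finset.forall_mem_cons]
  tauto

lemma HasRank.inf_orthogonal (hk : 0 < k) (hb : b.IsStrictlySkew) (h : HasRank k b N g)
    {f : Hom (stdForm k) b} (hf : f.range ≤ N) :
    HasRank k b (N ⊓ b.orthogonal f.range) (g - 1) := by
  have hker := (h.inf_ker hk hb (b f.rho)).inf_ker_of_radical (N := N ⊓ (b f.rho).ker) hk hb
    ⟨hf f.rho_mem_range, hb.self_eq_zero _⟩ f.nsmul_rho inf_le_right f.form_rho_sigma
  refine hker.mono (fun x hx => ⟨hx.1.1, ?_⟩) le_rfl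
  exact (f.mem_orthogonal_range_iff hb).2 ⟨hx.1.2, hx.2⟩

lemma HasRank.perp (hk : 0 < k) (hb : b.IsStrictlySkew) (h : HasRank k b N g)
    (hN : ∀ f ∈ σ, f.range ≤ N)
    (hσ : ∀ f ∈ σ, ∀ f' ∈ σ, f ≠ f' → f.range ≤ b.orthogonal f'.range) :
    HasRank k b (perp N σ) (g - σ.card) := by
  induction σ using Finset.cons_induction with
  | empty => exact h.mono (le_perp_iff.2 ⟨le_rfl, by simp⟩) (Nat.sub_le _ _)
  | cons f σ hf ih =>
    simp only [Finset.forall_mem_cons] at hN hσ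
    have hfσ : f.range ≤ Linking.perp N σ :=
      le_perp_iff.2 ⟨hN.1, fun f' hf' => hσ.1.2 f' hf' fun hff' => hf (hff' ▸ hf')⟩
    rw [Finset.card_cons, ← Nat.sub_sub, perp_cons]
    exact (ih hN.2 fun f' hf' => (hσ.2 f' hf').2).inf_orthogonal hk hb hfσ

end Perp

/-! ### Ranks and stable ranks -/

section StableRank

variable {M N : Type*} [AddCommGroup M] [AddCommGroup N] {k : ℕ} {b : Form M} {c : Form N} {g : ℕ}

lemma Form.directSum_apply (b : Form M) (c : Form N) (x y : M × N) :
    b.directSum c x y = b x.1 y.1 + c x.2 y.2 := by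
  simp [Form.directSum]

lemma Form.power_apply (b : Form M) (g : ℕ) (x y : Fin g → M) :
    b.power g x y = ∑ i, b (x i) (y i) := by
  simp [Form.power, AddMonoidHom.finsetSum_apply]

lemma Form.power_single_right (b : Form M) (g : ℕ) (x : Fin g → M) (i : Fin g) (y : M) :
    b.power g x (Pi.single i y) = b (x i) y := by
  rw [power_apply, Finset.sum_eq_single i]
  · rw [Pi.single_eq_same]
  · intro j _ hj
    rw [Pi.single_eq_of_ne hj, map_zero]
  · simp

lemma Form.IsStrictlySkew.directSum (hb : b.IsStrictlySkew) (hc : c.IsStrictlySkew) :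
    (b.directSum c).IsStrictlySkew where
  skew x y := by
    rw [directSum_apply, directSum_apply, hb.skew, hc.skew, neg_add]
  self_eq_zero x := by
    rw [directSum_apply, hb.self_eq_zero, hc.self_eq_zero, add_zero]

lemma Form.IsStrictlySkew.power (hb : b.IsStrictlySkew) (g : ℕ) :
    (b.power g).IsStrictlySkew where
  skew x y := by
    simp only [power_apply, ← Finset.sum_neg_distrib, ← hb.skew]
  self_eq_zero x := by
    simp only [power_apply, hb.self_eq_zero, Finset.sum_const_zero]

/-- The inclusion of the `i`-th summand. -/
def Hom.single (b : Form M) (g : ℕ) (i : Fin g) : Hom b (b.power g) where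
  toFun := AddMonoidHom.single (fun _ => M) i
  map_form x y := by
    rw [AddMonoidHom.single_apply, AddMonoidHom.single_apply, Form.power_single_right,
      Pi.single_eq_same]

/-- The inclusion of the second summand. -/
def Hom.inr (b : Form M) (c : Form N) : Hom c (b.directSum c) where
  toFun := AddMonoidHom.inr M N
  map_form x y := by simp [Form.directSum_apply]

/-- The composition of two morphisms of linking forms. -/
def Hom.comp {P : Type*} [AddCommGroup P] {d : Form P} (f : Hom c d) (f' : Hom b c) : Hom b d where
  toFun := f.toFun.comp f'.toFun
  map_form x y := (f.map_form _ _).trans (f'.map_form x y)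

lemma Hom.range_comp_single_le_orthogonal (f : Hom (b.power g) c) {i j : Fin g} (hij : i ≠ j) :
    (f.comp (single b g i)).range ≤ c.orthogonal (f.comp (single b g j)).range := by
  rintro _ ⟨x, rfl⟩ _ ⟨y, rfl⟩
  change c (f.toFun (Pi.single i x)) (f.toFun (Pi.single j y)) = 0
  rw [f.map_form, Form.power_single_right, Pi.single_eq_of_ne hij.symm, map_zero,
    AddMonoidHom.zero_apply]

lemma Hom.hasRank_top (f : Hom ((stdForm k).power g) b) : HasRank k b ⊤ g := by
  have h := hasRank_card Finset.univ (fun i => f.comp (single (stdForm k) g i))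
    (fun _ _ => le_top) fun i _ j _ hij => f.range_comp_single_le_orthogonal hij
  rwa [Finset.card_fin] at h

lemma HasRank.of_directSum_power {h : ℕ} (hk : 0 < k) (hb : b.IsStrictlySkew)
    (hr : HasRank k (b.directSum ((stdForm k).power h)) ⊤ (g + h)) : HasRank k b ⊤ g := by
  classical
  set c := b.directSum ((stdForm k).power h)
  have hc : c.IsStrictlySkew := hb.directSum ((isStrictlySkew_stdForm k).power h)
  let v (i : Fin h) : Hom (stdForm k) c := (Hom.inr b _).comp (Hom.single (stdForm k) h i)
  have horth : ∀ f ∈ Finset.univ.image v, ∀ f' ∈ Finset.univ.image v, f ≠ f' →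
      f.range ≤ c.orthogonal f'.range := by
    simp only [Finset.forall_mem_image]
    intro i _ j _ hij
    exact (Hom.inr b _).range_comp_single_le_orthogonal fun h => hij (h ▸ rfl)
  have hcard : (Finset.univ.image v).card ≤ h := by
    simpa using Finset.card_image_le (s := Finset.univ) (f := v)
  have hsnd : ∀ x ∈ Linking.perp ⊤ (Finset.univ.image v), x.2 = 0 := by
    intro x hx
    funext i
    refine eq_zero_of_forall_stdForm_eq_zero hk fun y => ?_
    have hxy : c x (0, Pi.single i y) = 0 :=
      (mem_perp.1 hx).2 (v i) (Finset.mem_image_of_mem v (Finset.mem_univ i)) _ ⟨y, rfl⟩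
    simpa [c, Form.directSum_apply, Form.power_single_right] using hxy
  have hform : ∀ x ∈ Linking.perp ⊤ (Finset.univ.image v),
      ∀ y ∈ Linking.perp ⊤ (Finset.univ.image v),
        b (AddMonoidHom.fst _ _ x) (AddMonoidHom.fst _ _ y) = c x y := by
    intro x _ y hy
    simp [c, Form.directSum_apply, hsnd y hy]
  exact ((hr.perp hk hc (fun _ _ => le_top) horth).map _ hform).mono le_top (by omega)

lemma hasRank_of_le_stableRank (hk : 0 < k) (hb : b.IsStrictlySkew)
    (hg : (g : ℤ) ≤ stableRank k b) : HasRank k b ⊤ g := by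
  rcases Nat.eq_zero_or_pos g with rfl | hpos
  · trivial
  -- An unbounded set of integers has supremum `0`, which is less than `g`.
  have hbdd : BddAbove (Set.range fun h : ℕ =>
      (kRank k (b.directSum ((stdForm k).power h)) : ℤ) - h) := by
    by_contra hn
    rw [stableRank, Int.csSup_of_not_bddAbove hn] at hg
    omega
  obtain ⟨h, hh : _ = stableRank k b⟩ := Int.csSup_mem (Set.range_nonempty _) hbdd
  have hle : g + h ≤ kRank k (b.directSum ((stdForm k).power h)) := by
    simp only at hh
    omega
  obtain ⟨f⟩ : kRank k (b.directSum ((stdForm k).power h)) ∈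
      {n : ℕ | Nonempty (Hom ((stdForm k).power n) (b.directSum ((stdForm k).power h)))} := by
    refine Nat.sSup_mem (Set.nonempty_iff_ne_empty.2 fun hempty => ?_)
      (by_contra fun hunbdd => ?_)
    · rw [kRank, hempty, csSup_empty, Nat.bot_eq_zero] at hle
      omega
    · rw [kRank, Nat.sSup_of_not_bddAbove hunbdd] at hle
      omega
  exact HasRank.of_directSum_power hk hb (f.hasRank_top.mono le_rfl hle)

end StableRank

open Complexes

/-! ### Connectivity of the linking complex -/

section ComplexWithin

variable {M : Type*} [AddCommGroup M] {k : ℕ} {b : Form M} {N N' N'' : AddSubgroup M}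
  {σ τ : Finset (Hom (stdForm k) b)} {v : Hom (stdForm k) b} {g m : ℕ}

/-- The simplices of `linkingComplex k b` whose vertices have images in `N`, together with the
empty simplex. Orthogonality of distinct vertices is required in one direction only; for skew `b`
and `k ≠ 0` this amounts to `Form.AreOrthogonal`, see `Hom.areOrthogonal_range_iff`. -/
def complexWithin (k : ℕ) (b : Form M) (N : AddSubgroup M) :
    LowerSet (Finset (Hom (stdForm k) b)) where
  carrier := {s | (∀ f ∈ s, f.range ≤ N) ∧
    ∀ f ∈ s, ∀ f' ∈ s, f ≠ f' → f.range ≤ b.orthogonal f'.range}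
  lower' := fun _ _ h hs => ⟨fun f hf => hs.1 f (h hf),
    fun f hf f' hf' => hs.2 f (h hf) f' (h hf')⟩

/-- The simplices of `complexWithin k b N` whose vertices other than `v` have images in `N'`. -/
def complexWithinExcept (N : AddSubgroup M) (v : Hom (stdForm k) b) (N' : AddSubgroup M) :
    LowerSet (Finset (Hom (stdForm k) b)) where
  carrier := {s | s ∈ complexWithin k b N ∧ ∀ f ∈ s, f ≠ v → f.range ≤ N'}
  lower' := fun _ _ h hs => ⟨(complexWithin k b N).lower h hs.1, fun f hf => hs.2 f (h hf)⟩

lemma empty_mem_complexWithin : ∅ ∈ complexWithin k b N :=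
  ⟨by simp, by simp⟩

lemma empty_mem_complexWithinExcept : ∅ ∈ complexWithinExcept N v N' :=
  ⟨empty_mem_complexWithin, by simp⟩

lemma complexWithinExcept_mono (h : N'' ≤ N') :
    complexWithinExcept N v N'' ≤ complexWithinExcept N v N' :=
  fun _ hσ => ⟨hσ.1, fun f hf hfv => (hσ.2 f hf hfv).trans h⟩

lemma complexWithinExcept_self : complexWithinExcept N v N = complexWithin k b N :=
  le_antisymm (fun _ hσ => hσ.1) fun _ hσ => ⟨hσ, fun f hf _ => hσ.1 f hf⟩

lemma union_mem_complexWithin [DecidableEq (Hom (stdForm k) b)] (hb : b.IsStrictlySkew)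
    (hτ : τ ∈ complexWithin k b N) (hσ : σ ∈ complexWithin k b N)
    (h : ∀ f ∈ τ, ∀ f' ∈ σ, f.range ≤ b.orthogonal f'.range) :
    τ ∪ σ ∈ complexWithin k b N := by
  refine ⟨fun f hf => (Finset.mem_union.1 hf).elim (hτ.1 f) (hσ.1 f), fun f hf f' hf' hne => ?_⟩
  rcases Finset.mem_union.1 hf with hf | hf <;> rcases Finset.mem_union.1 hf' with hf' | hf'
  · exact hτ.2 f hf f' hf' hne
  · exact h f hf f' hf'
  · exact hb.le_orthogonal_comm.1 (h f' hf' f hf)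
  · exact hσ.2 f hf f' hf' hne

lemma mem_complexWithin_perp_iff [DecidableEq (Hom (stdForm k) b)] (hb : b.IsStrictlySkew)
    (hN : N' ≤ N) (hσ : σ ∈ complexWithin k b N) (hστ : Disjoint τ σ) :
    τ ∈ complexWithin k b (perp N' σ) ↔
      (∀ f ∈ τ, f.range ≤ N') ∧ τ ∪ σ ∈ complexWithin k b N := by
  constructor
  · rintro ⟨hτ, horth⟩
    simp only [le_perp_iff] at hτ
    exact ⟨fun f hf => (hτ f hf).1, union_mem_complexWithin hb
      ⟨fun f hf => (hτ f hf).1.trans hN, horth⟩ hσ fun f hf => (hτ f hf).2⟩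
  · rintro ⟨hτ, horth⟩
    exact ⟨fun f hf => le_perp_iff.2 ⟨hτ f hf, fun f' hf' =>
        horth.2 f (Finset.mem_union_left σ hf) f' (Finset.mem_union_right τ hf')
          (Finset.disjoint_iff_ne.1 hστ f hf f' hf')⟩,
      ((complexWithin k b N).lower Finset.subset_union_left horth).2⟩

lemma conn_complexWithinExcept_inf_orthogonal [Fintype (Hom (stdForm k) b)] (m : ℕ)
    (hb : b.IsStrictlySkew) (hv : v.range ≤ N) :
    Conn m (complexWithinExcept N v (N ⊓ b.orthogonal v.range)) := by
  classical
  refine conn_of_insert_mem m (v := v) ⟨∅, empty_mem_complexWithinExcept⟩ fun σ hσ => ?_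
  have horth : ∀ f ∈ σ, f ≠ v → f.range ≤ b.orthogonal v.range :=
    fun f hf hfv => (hσ.2 f hf hfv).trans inf_le_right
  refine ⟨⟨(Finset.forall_mem_insert ..).2 ⟨hv, hσ.1.1⟩, fun f hf f' hf' hne => ?_⟩,
    (Finset.forall_mem_insert ..).2 ⟨fun h => (h rfl).elim, hσ.2⟩⟩
  rcases Finset.mem_insert.1 hf with rfl | hfσ <;> rcases Finset.mem_insert.1 hf' with rfl | hfσ'
  · exact (hne rfl).elim
  · exact hb.le_orthogonal_comm.1 (horth f' hfσ' hne.symm)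
  · exact horth f hfσ hne
  · exact hσ.1.2 f hfσ f' hfσ' hne

open Classical in
lemma linkWithin_complexWithinExcept [Fintype (Hom (stdForm k) b)]
    [DecidableEq (Hom (stdForm k) b)] (hb : b.IsStrictlySkew) (hN'' : N'' ≤ N') (hN' : N' ≤ N)
    (hσ : σ ∈ complexWithin k b N') (hσN'' : ∀ f ∈ σ, ¬ f.range ≤ N'') :
    linkWithin (complexWithinExcept N v N') {f | f.range ≤ N''} σ =
      complexWithin k b (perp N'' σ) := by
  have hdisj {τ : Finset (Hom (stdForm k) b)} (hτ : ∀ f ∈ τ, f.range ≤ N'') : Disjoint τ σ :=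
    Finset.disjoint_left.2 fun f hf hfσ => hσN'' f hfσ (hτ f hf)
  have hσN : σ ∈ complexWithin k b N := ⟨fun f hf => (hσ.1 f hf).trans hN', hσ.2⟩
  ext τ
  constructor
  · rintro ⟨hτ, hτσ⟩
    have hτ : ∀ f ∈ τ, f.range ≤ N'' := fun f hf => (Finset.mem_filter.1 (hτ hf)).2
    exact (mem_complexWithin_perp_iff hb (hN''.trans hN') hσN (hdisj hτ)).2 ⟨hτ, hτσ.1⟩
  · intro h
    have hτ : ∀ f ∈ τ, f.range ≤ N'' := fun f hf => (le_perp_iff.1 (h.1 f hf)).1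
    have hτσ := ((mem_complexWithin_perp_iff hb (hN''.trans hN') hσN (hdisj hτ)).1 h).2
    refine ⟨fun f hf => Finset.mem_filter.2 ⟨Finset.mem_univ f, hτ f hf⟩, hτσ, fun f hf _ => ?_⟩
    exact (Finset.mem_union.1 hf).elim (fun hf => (hτ f hf).trans hN'') (hσ.1 f)

lemma conn_complexWithinExcept_of_le [Fintype (Hom (stdForm k) b)] (hb : b.IsStrictlySkew)
    (hv : N ⊓ b.orthogonal v.range ≤ N'') (hN'' : N'' ≤ N') (hN' : N' ≤ N)
    (hconn : Conn m (complexWithinExcept N v N''))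
    (hperp : ∀ σ ∈ complexWithin k b N', σ.Nonempty →
      Conn (m - σ.card) (complexWithin k b (perp N'' σ))) :
    Conn m (complexWithinExcept N v N') := by
  classical
  refine conn_of_linkWithin {f | f.range ≤ N''} (complexWithinExcept_mono hN'')
    empty_mem_complexWithinExcept (fun ξ hξ hξV => ⟨hξ.1, fun f hf hfv => ?_⟩) hconn
    fun σ hσ hσT hσV => ?_
  · by_contra hfN
    exact hfN (hξV.2 f (by simpa using ⟨hf, hfN⟩) hfv)
  · have hvσ : v ∉ σ := fun hvσ => hσT ⟨hσ.1, fun f hf hfv =>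
      (le_inf (hσ.1.1 f hf) (hσ.1.2 f hf v hvσ hfv)).trans hv⟩
    have hσN' : ∀ f ∈ σ, f.range ≤ N' := fun f hf => hσ.2 f hf fun hfv => hvσ (hfv ▸ hf)
    have hσ0 : σ.Nonempty := Finset.nonempty_iff_ne_empty.2 fun h =>
      hσT (h ▸ empty_mem_complexWithinExcept)
    have hσN'' : ∀ f ∈ σ, ¬ f.range ≤ N'' := fun f hf h =>
      Finset.disjoint_left.1 hσV hf (by simpa using h)
    rw [linkWithin_complexWithinExcept hb hN'' hN' ⟨hσN', hσ.1.2⟩ hσN'']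
    exact hperp σ ⟨hσN', hσ.1.2⟩ hσ0

theorem conn_complexWithin [Fintype (Hom (stdForm k) b)] (hk : 0 < k) (hb : b.IsStrictlySkew)
    (h : HasRank k b N g) : Conn (g / 2) (complexWithin k b N) := by
  classical
  induction g using Nat.strong_induction_on generalizing N with
  | _ g ih =>
  obtain hg | ⟨g, rfl⟩ : g < 2 ∨ ∃ g', g = g' + 2 :=
    (lt_or_ge g 2).imp_right Nat.exists_eq_add_of_le'
  · rw [Nat.div_eq_of_lt hg]
    exact conn_zero _
  obtain ⟨v, hv⟩ : ∃ v : Hom (stdForm k) b, v.range ≤ N := h.imp fun _ => And.left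
  set N₂ := N ⊓ (b v.rho).ker
  set N₁ := N₂ ⊓ (b v.sigma).ker
  have hN₁ : N₁ = N ⊓ b.orthogonal v.range := by
    ext x
    simp only [N₁, N₂, AddSubgroup.mem_inf, v.mem_orthogonal_range_iff hb, AddMonoidHom.mem_ker,
      and_assoc]
  have hrank {σ : Finset (Hom (stdForm k) b)} (hσ : σ ∈ complexWithin k b N) :
      HasRank k b (perp N₂ σ) (g + 2 - σ.card - 1) := by
    rw [perp_inf]
    exact (h.perp hk hb hσ.1 hσ.2).inf_ker hk hb _
  have hconn₁ : Conn ((g + 2) / 2) (complexWithinExcept N v N₁) :=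
    hN₁ ▸ conn_complexWithinExcept_inf_orthogonal _ hb hv
  have hconn₂ : Conn ((g + 2) / 2) (complexWithinExcept N v N₂) := by
    refine conn_complexWithinExcept_of_le hb hN₁.ge inf_le_left inf_le_left hconn₁
      fun σ hσ hσ0 => ?_
    have hσcard := hσ0.card_pos
    have hrho : v.rho ∈ perp N₂ σ :=
      mem_perp.2 ⟨⟨hv v.rho_mem_range, hb.self_eq_zero _⟩, fun f hf y hy => (hσ.1 f hf hy).2⟩
    have hradical : perp N₂ σ ≤ (b v.rho).ker := fun x hx => (mem_perp.1 hx).1.2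
    have hrank₁ := (hrank ⟨fun f hf => (hσ.1 f hf).trans inf_le_left, hσ.2⟩).inf_ker_of_radical
      hk hb hrho v.nsmul_rho hradical v.form_rho_sigma
    rw [← perp_inf] at hrank₁
    exact (ih _ (by omega) hrank₁).anti (by omega)
  rw [← complexWithinExcept_self (v := v)]
  refine conn_complexWithinExcept_of_le hb (hN₁.ge.trans inf_le_left) inf_le_left le_rfl
    hconn₂ fun σ hσ hσ0 => ?_
  have hσcard := hσ0.card_pos
  exact (ih _ (by omega) (hrank hσ)).anti (by omega)

end ComplexWithin

section Main

variable {M : Type*} [AddCommGroup M] {k : ℕ} {b : Form M} {σ : Finset (Hom (stdForm k) b)}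

lemma mem_faces_linkingComplex_iff (hk : 0 < k) (hb : b.IsStrictlySkew) :
    σ ∈ (linkingComplex k b).faces ↔ σ.Nonempty ∧ σ ∈ complexWithin k b ⊤ := by
  refine and_congr_right fun _ => ⟨fun h => ⟨fun _ _ => le_top, fun f hf f' hf' hne => ?_⟩,
    fun h f hf f' hf' hne => ?_⟩
  · exact (h f hf f' hf' hne).1
  · exact (Hom.areOrthogonal_range_iff hk hb f f').2 (h.2 f hf f' hf' hne)

lemma augmentedFaces_linkingComplex (hk : 0 < k) (hb : b.IsStrictlySkew) :
    augmentedFaces (linkingComplex k b).toPreAbstractSimplicialComplex = complexWithin k b ⊤ := by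
  ext s
  rcases s.eq_empty_or_nonempty with rfl | hs
  · exact iff_of_true (fun h => (Finset.not_nonempty_empty h).elim) empty_mem_complexWithin
  · refine (forall_prop_of_true hs).trans ((mem_faces_linkingComplex_iff hk hb).trans ?_)
    exact and_iff_right hs

lemma augmentedFaces_link (hk : 2 ≤ k) (hb : b.IsStrictlySkew)
    (hσ : σ ∈ (linkingComplex k b).faces) :
    augmentedFaces (link (linkingComplex k b).toPreAbstractSimplicialComplex σ) =
      complexWithin k b (perp ⊤ σ) := by
  classical
  have hfaces {τ : Finset (Hom (stdForm k) b)} :=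
    mem_faces_linkingComplex_iff (σ := τ) (by omega : 0 < k) hb
  have hσ' := (hfaces.1 hσ).2
  ext τ
  rcases τ.eq_empty_or_nonempty with rfl | hτ0
  · exact iff_of_true (fun h => (Finset.not_nonempty_empty h).elim) empty_mem_complexWithin
  refine (forall_prop_of_true hτ0).trans ⟨?_, fun h => ?_⟩
  · rintro ⟨-, hdisj, ξ, hξ, hσξ, hτξ⟩
    exact (mem_complexWithin_perp_iff hb le_rfl hσ' hdisj).2 ⟨fun _ _ => le_top,
      (complexWithin k b ⊤).lower (Finset.union_subset hτξ hσξ) (hfaces.1 hξ).2⟩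
  · have hdisj : Disjoint τ σ := Finset.disjoint_left.2 fun f hf hfσ =>
      f.not_range_le_orthogonal_self hk ((le_perp_iff.1 (h.1 f hf)).2 f hfσ)
    have hτσ := hfaces.2 ⟨hτ0.mono Finset.subset_union_left,
      ((mem_complexWithin_perp_iff hb le_rfl hσ' hdisj).1 h).2⟩
    exact ⟨((linkingComplex k b).isRelLowerSet_faces hτσ).2 Finset.subset_union_left hτ0, hdisj,
      _, hτσ, Finset.subset_union_right, Finset.subset_union_left⟩

end Main

end Linking

end

theorem mainTheorem4_general (k : ℕ) (hk : 2 ≤ k) (g : ℕ) {M : Type*} [AddCommGroup M]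
    (b : Linking.Form M) [Finite (Linking.Hom (Linking.stdForm k) b)] (hb : b.IsStrictlySkew)
    (hg : (g : ℤ) ≤ Linking.stableRank k b) :
    Complexes.IsNConnected (((g : ℚ) - 4) / 2)
        (Complexes.Realization (Linking.linkingComplex k b).toPreAbstractSimplicialComplex) ∧
      Complexes.LocallyCMGE (Linking.linkingComplex k b).toPreAbstractSimplicialComplex
        (((g : ℚ) - 1) / 2) := by
  have hk0 : 0 < k := by omega
  have : Fintype (Linking.Hom (Linking.stdForm k) b) := Fintype.ofFinite _
  have hrank := Linking.hasRank_of_le_stableRank hk0 hb hg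
  refine ⟨Complexes.isNConnected_of_conn (m := g / 2) ?_ fun n hn => ?_, fun p σ hσ hcard =>
    Complexes.isNConnected_of_conn (m := (g - σ.card) / 2) ?_ fun n hn => ?_⟩
  · rw [Linking.augmentedFaces_linkingComplex hk0 hb]
    exact Linking.conn_complexWithin hk0 hb hrank
  · have : ((n * 2 : ℕ) : ℚ) ≤ g := by push_cast; linarith
    have : n * 2 ≤ g := by exact_mod_cast this
    omega
  · have hσ' := ((Linking.mem_faces_linkingComplex_iff hk0 hb).1 hσ).2
    rw [Linking.augmentedFaces_link hk hb hσ]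
    exact Linking.conn_complexWithin hk0 hb (hrank.perp hk0 hb hσ'.1 hσ'.2)
  · have : ((n * 2 + p * 2 + 1 : ℕ) : ℚ) ≤ g := by push_cast; linarith
    have : n * 2 + p * 2 + 1 ≤ g := by exact_mod_cast this
    omega

theorem mainTheorem4 (k : ℕ) (hk : 2 ≤ k) (g : ℕ)
    {M : Type*} [AddCommGroup M] [Finite M]
    (b : Linking.Form M) (hb : b.IsStrictlySkew)
    (hg : (g : ℤ) ≤ Linking.stableRank k b) :
    Complexes.IsNConnected (((g : ℚ) - 4) / 2)
        (Complexes.Realization (Linking.linkingComplex k b).toPreAbstractSimplicialComplex) ∧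
      Complexes.LocallyCMGE (Linking.linkingComplex k b).toPreAbstractSimplicialComplex
        (((g : ℚ) - 1) / 2) := by
  have : NeZero k := ⟨by omega⟩
  exact mainTheorem4_general k hk g b hb hg
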